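/- Let $k$ be an algebraically closed field of characteristic zero, let $d\ge 0$, let $S=k[[x_0,\dots,x_d]]$ be the ring of formal power series in $d+1$ variables, and let $f\in S$ be a nonzero element of the maximal ideal of $S$. Put $R=S/(f)$ and let $R^\sharp=S[[z]]/(f+z^2)$ be its double branched cover, so that $R=R^\sharp/(z)$. For $A\in\{R,R^\sharp\}$, a finitely generated $A$-module $M$ is called maximal Cohen-Macaulay if $\operatorname{depth} M\ge\dim A$ (with $\operatorname{depth} 0=\infty$). Its stable annihilator $\underline{\mathrm{ann}}_A M$ is the annihilator in $A$ of the stable endomorphism ring $\underline{\mathrm{End}}_A(M)=\mathrm{End}_A(M)/\{\text{endomorphisms that factor through a projective module}\}$. Let $\mathfrak{CM}(A)$ be the topological space whose points are the isomorphism classes of objects of the stable category of maximal Cohen-Macaulay $A$-modules, with the Alexandrov topology of the preorder $N\le M\iff\underline{\mathrm{ann}}_A N\subseteq\underline{\mathrm{ann}}_A M$, in which the closed sets are the downward closed sets; in particular the closure of a point $M$ is $\{N : N\le M\}$. The Kolmogorov quotient of a space is its quotient by topological indistinguishability. Then the Kolmogorov quotients of $\mathfrak{CM}(R^\sharp)$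 and $\mathfrak{CM}(R)$ are homeomorphic. More precisely, $M/zM$ is a maximal Cohen-Macaulay $R$-module for every maximal Cohen-Macaulay $R^\sharp$-module $M$; for every maximal Cohen-Macaulay $R$-module $N$, viewed as an $R^\sharp$-module, every syzygy $\Omega_{R^\sharp}N$ (the kernel of a surjection onto $N$ from a free $R^\sharp$-module of finite rank) is a maximal Cohen-Macaulay $R^\sharp$-module; and there is a homeomorphism from the Kolmogorov quotient of $\mathfrak{CM}(R^\sharp)$ onto that of $\mathfrak{CM}(R)$ which sends the class of $M$ to the class of $M/zM$, and whose inverse sends the class of $N$ to the class of $\Omega_{R^\sharp}N$. -/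

import Mathlib

universe u

noncomputable section

namespace AlexandrovMCM

open RingTheory.Sequence

/-! ## Maximal Cohen-Macaulay modules -/

section Depth

/-- The depth of a module over a (Noetherian) local ring: the supremum of the lengths of the
regular sequences on `M` consisting of elements of the maximal ideal (that is, of non-units),
and `⊤` for the zero module. `IsRegular M rs` says that `(rs) M ≠ M` and that every member of `rs`
is a nonzerodivisor on the quotient of `M` by the previous ones. -/
def depth (R : Type*) [CommRing R] (M : Type*) [AddCommGroup M] [Module R M] : ℕ∞ :=
  open Classical in
  if Subsingleton M then ⊤
  else ⨆ rs ∈ {rs : List R | (∀ r ∈ rs, r ∈ nonunits R) ∧ IsRegular M rs}, (rs.length : ℕ∞)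

/-- A maximal Cohen-Macaulay module over a (Noetherian) local ring: finitely generated,
of depth at least the Krull dimension of the ring. -/
def IsMCM (R : Type*) [CommRing R] (M : Type*) [AddCommGroup M] [Module R M] : Prop :=
  Module.Finite R M ∧ ringKrullDim R ≤ (depth R M : WithBot ℕ∞)

end Depth

/-! ## The stable category -/

section Stable

variable (R : Type u) [CommRing R]

/-- `P(M, N)`: the submodule of the homomorphisms `M → N` that factor through a (finitely
generated) projective module. -/
def projMaps (M N : Type u) [AddCommGroup M] [Module R M] [AddCommGroup N] [Module R N] :
    Submodule R (M →ₗ[R] N) where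
  carrier := {h | ∃ (P : Type u) (_ : AddCommGroup P) (_ : Module R P),
    Module.Finite R P ∧ Module.Projective R P ∧
      ∃ (a : M →ₗ[R] P) (b : P →ₗ[R] N), h = b ∘ₗ a}
  add_mem' := by
    rintro h h' ⟨P, _, _, _, _, a, b, rfl⟩ ⟨P', _, _, _, _, a', b', rfl⟩
    refine ⟨P × P', inferInstance, inferInstance, inferInstance, inferInstance,
      a.prod a', b.coprod b', ?_⟩
    ext x
    simp
  zero_mem' := ⟨PUnit, inferInstance, inferInstance, inferInstance, inferInstance, 0, 0, by simp⟩
  smul_mem' := by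
    rintro c h ⟨P, _, _, _, _, a, b, rfl⟩
    exact ⟨P, inferInstance, inferInstance, inferInstance, inferInstance, a, c • b, by ext; simp⟩

/-- The stable Hom module `Hom(M, N) / P(M, N)`. -/
abbrev StableHom (M N : Type u) [AddCommGroup M] [Module R M] [AddCommGroup N] [Module R N] :
    Type u :=
  (M →ₗ[R] N) ⧸ projMaps R M N

/-- The stable annihilator of `M`: the annihilator of its stable endomorphism ring. -/
def stableAnn (M : Type u) [AddCommGroup M] [Module R M] : Ideal R :=
  Module.annihilator R (StableHom R M M)

/-- `M` and `N` are isomorphic in the stable category: there are homomorphisms `M → N` and `N → M`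
whose two composites become identities modulo homomorphisms factoring through a projective. -/
def StablyIso (M N : Type u) [AddCommGroup M] [Module R M] [AddCommGroup N] [Module R N] : Prop :=
  ∃ (a : M →ₗ[R] N) (b : N →ₗ[R] M),
    b ∘ₗ a - LinearMap.id ∈ projMaps R M M ∧ a ∘ₗ b - LinearMap.id ∈ projMaps R N N

variable {R}

theorem projMaps_comp {M N L K : Type u} [AddCommGroup M] [Module R M] [AddCommGroup N] [Module R N]
    [AddCommGroup L] [Module R L] [AddCommGroup K] [Module R K] {h : N →ₗ[R] L}
    (hh : h ∈ projMaps R N L) (a : M →ₗ[R] N) (b : L →ₗ[R] K) :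
    b ∘ₗ h ∘ₗ a ∈ projMaps R M K := by
  obtain ⟨P, _, _, _, _, a', b', rfl⟩ := hh
  exact ⟨P, inferInstance, inferInstance, inferInstance, inferInstance, a' ∘ₗ a, b ∘ₗ b', rfl⟩

theorem StablyIso.refl (M : Type u) [AddCommGroup M] [Module R M] : StablyIso R M M :=
  ⟨LinearMap.id, LinearMap.id, by simp, by simp⟩

theorem StablyIso.symm {M N : Type u} [AddCommGroup M] [Module R M] [AddCommGroup N] [Module R N]
    (h : StablyIso R M N) : StablyIso R N M := by
  obtain ⟨a, b, h1, h2⟩ := h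
  exact ⟨b, a, h2, h1⟩

theorem StablyIso.trans {M N L : Type u} [AddCommGroup M] [Module R M] [AddCommGroup N] [Module R N]
    [AddCommGroup L] [Module R L] (h : StablyIso R M N) (h' : StablyIso R N L) :
    StablyIso R M L := by
  obtain ⟨a, b, h1, h2⟩ := h
  obtain ⟨a', b', h1', h2'⟩ := h'
  refine ⟨a' ∘ₗ a, b ∘ₗ b', ?_, ?_⟩
  · have := add_mem (projMaps_comp h1' a b) h1
    convert this using 1
    ext x
    simp
  · have := add_mem (projMaps_comp h2 b' a') h2'
    convert this using 1
    ext x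
    simp

theorem mem_stableAnn_iff {M : Type u} [AddCommGroup M] [Module R M] {r : R} :
    r ∈ stableAnn R M ↔ r • (LinearMap.id : M →ₗ[R] M) ∈ projMaps R M M := by
  rw [stableAnn, Module.mem_annihilator]
  constructor
  · intro h
    have := h (Submodule.Quotient.mk LinearMap.id)
    rwa [← Submodule.Quotient.mk_smul, Submodule.Quotient.mk_eq_zero] at this
  · intro h x
    obtain ⟨g, rfl⟩ := Submodule.Quotient.mk_surjective _ x
    rw [← Submodule.Quotient.mk_smul, Submodule.Quotient.mk_eq_zero]
    convert projMaps_comp h LinearMap.id g using 1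
    ext x
    simp

theorem StablyIso.stableAnn_le {M N : Type u} [AddCommGroup M] [Module R M] [AddCommGroup N]
    [Module R N] (h : StablyIso R M N) : stableAnn R M ≤ stableAnn R N := by
  obtain ⟨a, b, -, h2⟩ := h
  intro r hr
  rw [mem_stableAnn_iff] at hr ⊢
  have := sub_mem (projMaps_comp hr b a) ((projMaps R N N).smul_mem r h2)
  convert this using 1
  ext x
  simp [smul_sub]

theorem StablyIso.stableAnn_eq {M N : Type u} [AddCommGroup M] [Module R M] [AddCommGroup N]
    [Module R N] (h : StablyIso R M N) : stableAnn R M = stableAnn R N :=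
  le_antisymm h.stableAnn_le h.symm.stableAnn_le

end Stable

/-! ## The Alexandrov space of maximal Cohen-Macaulay modules -/

section Space

variable (R : Type u) [CommRing R]

/-- The objects of the (stable) category of maximal Cohen-Macaulay `R`-modules. -/
structure MCMModule : Type (u + 1) where
  carrier : Type u
  [addCommGroup : AddCommGroup carrier]
  [module : Module R carrier]
  isMCM : IsMCM R carrier

attribute [instance] MCMModule.addCommGroup MCMModule.module

/-- Isomorphism in the stable category of maximal Cohen-Macaulay modules. -/
def stableSetoid : Setoid (MCMModule R) where
  r M N := StablyIso R M.carrier N.carrier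
  iseqv := ⟨fun M => StablyIso.refl M.carrier, StablyIso.symm, StablyIso.trans⟩

/-- The points of the Alexandrov space of maximal Cohen-Macaulay modules: the isomorphism classes
of objects of the stable category of maximal Cohen-Macaulay `R`-modules. -/
def CM : Type (u + 1) := Quotient (stableSetoid R)

variable {R}

/-- The point given by a maximal Cohen-Macaulay module. -/
def CM.of (M : Type u) [AddCommGroup M] [Module R M] (hM : IsMCM R M) : CM R :=
  Quotient.mk (stableSetoid R) ⟨M, hM⟩

/-- The stable annihilator of a point. -/
def CM.ann : CM R → Ideal R :=
  Quotient.lift (s := stableSetoid R) (fun M => stableAnn R M.carrier)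
    (fun _ _ h => StablyIso.stableAnn_eq h)

/-- `N ≤ M` if and only if the stable annihilator of `N` is contained in that of `M`. -/
instance : Preorder (CM R) := Preorder.lift CM.ann

/-- The Alexandrov topology of the preorder, in which the closure of a point `M` is the set
of all `N ≤ M`: the closed sets are the lower sets, the open sets are the upper sets. -/
instance : TopologicalSpace (CM R) := Topology.upperSet (CM R)

end Space

/-! ## Hypersurfaces and double branched covers -/

section Branched

variable {S : Type u} [CommRing S]

/-- The ring `R = S/(f)`. -/
abbrev Hypersurface (f : S) : Type u := S ⧸ Ideal.span {f}

/-- The ring `R^♯ = S⟦z⟧/(f + z²)`. -/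
abbrev BranchedCover (f : S) : Type u :=
  PowerSeries S ⧸ Ideal.span {(PowerSeries.C f + PowerSeries.X ^ 2 : PowerSeries S)}

/-- The class of the variable `z` in `R^♯`. -/
def zVar (f : S) : BranchedCover f := Ideal.Quotient.mk _ PowerSeries.X

/-- The ring homomorphism `R^♯ → R` sending `z` to `0`. -/
def toHypersurface (f : S) : BranchedCover f →+* Hypersurface f :=
  Ideal.quotientMap (Ideal.span {f}) (PowerSeries.constantCoeff (R := S)) (by
    rw [Ideal.span_singleton_le_iff_mem, Ideal.mem_comap]
    simp)

/-- The ring homomorphism `R → R^♯/(z)` induced by the inclusion of `S` in `S⟦z⟧`. -/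
def fromHypersurface (f : S) : Hypersurface f →+* BranchedCover f ⧸ Ideal.span {zVar f} :=
  Ideal.Quotient.lift (Ideal.span {f})
    (((Ideal.Quotient.mk (Ideal.span {zVar f})).comp
      (Ideal.Quotient.mk (Ideal.span {(PowerSeries.C f + PowerSeries.X ^ 2 : PowerSeries S)}))).comp
        PowerSeries.C)
    (by
      suffices h : Ideal.span {f} ≤ RingHom.ker
          (((Ideal.Quotient.mk (Ideal.span {zVar f})).comp (Ideal.Quotient.mk
            (Ideal.span {(PowerSeries.C f + PowerSeries.X ^ 2 : PowerSeries S)}))).comp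
              PowerSeries.C) from fun a ha => h ha
      rw [Ideal.span_singleton_le_iff_mem, RingHom.mem_ker, RingHom.comp_apply,
        RingHom.comp_apply, Ideal.Quotient.eq_zero_iff_mem, Ideal.mem_span_singleton]
      refine ⟨-zVar f, ?_⟩
      rw [zVar, ← map_neg, ← map_mul, Ideal.Quotient.eq, Ideal.mem_span_singleton]
      exact ⟨1, by ring⟩)

/-- The quotient `M/zM` of an `R^♯`-module `M`. -/
def ModZ (f : S) (M : Type u) [AddCommGroup M] [Module (BranchedCover f) M] : Type u :=
  M ⧸ (Ideal.span {zVar f} • ⊤ : Submodule (BranchedCover f) M)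

instance (f : S) (M : Type u) [AddCommGroup M] [Module (BranchedCover f) M] :
    AddCommGroup (ModZ f M) :=
  inferInstanceAs (AddCommGroup (M ⧸ (Ideal.span {zVar f} • ⊤ : Submodule (BranchedCover f) M)))

/-- `M/zM` as an `R`-module: it is naturally a module over `R^♯/(z)`, which is `R`. -/
instance (f : S) (M : Type u) [AddCommGroup M] [Module (BranchedCover f) M] :
    Module (Hypersurface f) (ModZ f M) :=
  Module.compHom (M ⧸ (Ideal.span {zVar f} • ⊤ : Submodule (BranchedCover f) M))
    (fromHypersurface f)

/-- An `R`-module `N`, viewed as an `R^♯`-module through `R^♯ → R`. -/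
def Res (f : S) (N : Type u) [AddCommGroup N] [Module (Hypersurface f) N] : Type u :=
  have _ := f
  N

instance (f : S) (N : Type u) [AddCommGroup N] [Module (Hypersurface f) N] :
    AddCommGroup (Res f N) :=
  inferInstanceAs (AddCommGroup N)

instance (f : S) (N : Type u) [AddCommGroup N] [Module (Hypersurface f) N] :
    Module (BranchedCover f) (Res f N) :=
  Module.compHom N (toHypersurface f)

end Branched

end AlexandrovMCM

end

/-! Write `♯` for the double cover, `K = ΩN` for the kernel of `g : (R♯)ⁿ → N`, and `σ : R♯ → R` for
`z ↦ 0`. The theorem reduces to two identities of ideals: `ann M = σ⁻¹ ann (M/zM)` for `M` maximal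
Cohen-Macaulay over `R♯`, and `ann ΩN = σ⁻¹ ann N` for `N` over `R`. Two points are
indistinguishable exactly when their annihilators agree, and `I ↦ σ⁻¹ I` is an order embedding
because `σ` is surjective, so maps satisfying these identities induce mutually inverse
homeomorphisms.

Three facts give the identities. A factorization of `c • id` through a free module survives
reduction modulo `z` (`stableAnn_le_comap_stableAnn_modZ`). A factorization on `N` lifts to one on
`ΩN` (`comap_stableAnn_le_stableAnn_ker`). Passing to a direct summand can only enlarge the
annihilator (`stableAnn_le_of_leftInverse`). It remains to see that `N` is a summand of `ΩN/zΩN`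
(`exists_section_syzygyRetraction`), and that `M` is a summand of `Ω(M/zM)` (inside
`comap_stableAnn_modZ_le`).

The second splitting needs `z` to be regular on `M` and `z • id` to be stably zero. Both follow from
`M` being free over the regular ring `S`, over which `R♯` is finite with `z² = -f`: the map `2z` on
`M` factors through `R♯ ⊗ M`, the tensor product being over `S`, and `2` is invertible. Freeness
over `S` is a depth argument, `free_of_natCast_le_depth`. -/

namespace AlexandrovMCM
open RingTheory.Sequence IsLocalRing CategoryTheory Abelian
open scoped Pointwise TensorProduct

/-! ### Depth: cohomological characterization and exact sequences. -/

section Depth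

variable {A : Type u} [CommRing A] [IsLocalRing A]

theorem maximalIdeal_smul_top_lt_top (M : Type*) [AddCommGroup M] [Module A M]
    [Module.Finite A M] [Nontrivial M] :
    maximalIdeal A • (⊤ : Submodule A M) < ⊤ :=
  (Submodule.top_ne_ideal_smul_of_le_jacobson_annihilator
    (maximalIdeal_le_jacobson _)).symm.lt_top

theorem natCast_le_depth_of_isRegular {M : Type*} [AddCommGroup M] [Module A M] {rs : List A}
    (hmem : ∀ r ∈ rs, r ∈ maximalIdeal A) (hreg : IsRegular M rs) :
    (rs.length : ℕ∞) ≤ depth A M := by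
  unfold depth
  split_ifs
  · exact le_top
  · exact le_iSup₂_of_le (f := fun (rs : List A) _ => (rs.length : ℕ∞)) rs
      ⟨hmem, hreg⟩ le_rfl

theorem exists_isRegular_of_natCast_le_depth {M : Type*} [AddCommGroup M] [Module A M]
    [Nontrivial M] {n : ℕ} (h : (n : ℕ∞) ≤ depth A M) :
    ∃ rs : List A, n ≤ rs.length ∧ (∀ r ∈ rs, r ∈ maximalIdeal A) ∧ IsRegular M rs := by
  rcases n with _ | n
  -- The contradiction below bounds the supremum by the predecessor of the target length, so length
  -- zero is separate.
  · exact ⟨[], by simp, by simp, .nil A M⟩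
  by_contra! hcon
  rw [depth, if_neg (not_subsingleton M)] at h
  have : (⨆ rs ∈ {rs : List A | (∀ r ∈ rs, r ∈ nonunits A) ∧ IsRegular M rs},
      (rs.length : ℕ∞)) ≤ n := by
    refine iSup₂_le fun rs hrs => ?_
    by_contra! hlt
    exact hcon rs (by exact_mod_cast Order.add_one_le_of_lt hlt) hrs.1 hrs.2
  have := h.trans this
  norm_cast at this
  omega

theorem natCast_add_one_le_depth_of_quotSMulTop {M : Type*} [AddCommGroup M] [Module A M]
    [Module.Finite A M] {x : A} (hxm : x ∈ maximalIdeal A)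
    (hx : IsSMulRegular M x) {n : ℕ}
    (hM : (n : ℕ∞) ≤ depth A (QuotSMulTop x M)) : ((n + 1 : ℕ) : ℕ∞) ≤ depth A M := by
  rcases subsingleton_or_nontrivial M with h | h
  · simp [depth, h]
  have : Nontrivial (QuotSMulTop x M) := nontrivial_quotSMulTop_of_mem_maximalIdeal _ hxm
  obtain ⟨rs, hlen, hmem, hreg⟩ := exists_isRegular_of_natCast_le_depth hM
  refine le_trans ?_ (natCast_le_depth_of_isRegular (rs := x :: rs) (by simpa using ⟨hxm, hmem⟩)
    (hreg.cons hx))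
  simpa using hlen

variable [IsNoetherianRing A]

/-- Rees' theorem for the residue field. It makes depth accessible to long exact sequences; the zero
module fits because its depth is `⊤` and all its `Ext` groups vanish. -/
theorem natCast_le_depth_iff_ext (M : Type u) [AddCommGroup M] [Module A M] [Module.Finite A M]
    (n : ℕ) : (n : ℕ∞) ≤ depth A M ↔ ∀ i < n,
      Subsingleton (Ext (ModuleCat.of A (A ⧸ maximalIdeal A)) (ModuleCat.of A M) i) := by
  have hsupp : Module.support A (A ⧸ maximalIdeal A) =
      PrimeSpectrum.zeroLocus (maximalIdeal A : Set A) := by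
    rw [Module.support_eq_zeroLocus, Ideal.annihilator_quotient]
  rcases subsingleton_or_nontrivial M with hM | hM
  · refine iff_of_true (by simp [depth, hM]) fun i _ => ?_
    refine subsingleton_of_forall_eq 0 fun x => ?_
    have h0 : 𝟙 (ModuleCat.of A M) = 0 := by
      ext m; exact Subsingleton.elim (α := M) _ _
    rw [← Ext.comp_mk₀_id x, h0, Ext.mk₀_zero, Ext.comp_zero]
  · constructor
    · intro h i hi
      obtain ⟨rs, hlen, hmem, hreg⟩ := exists_isRegular_of_natCast_le_depth h
      exact ModuleCat.subsingleton_ext_of_exists_isRegular (maximalIdeal A)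
        (ModuleCat.of A (A ⧸ maximalIdeal A)) hsupp.subset (ModuleCat.of A M)
        (maximalIdeal_smul_top_lt_top M) rs hmem hreg i (hi.trans_le hlen)
    · intro h
      obtain ⟨rs, rfl, hmem, hreg⟩ := ModuleCat.exists_isRegular_of_exists_subsingleton_ext
        (maximalIdeal A) n (ModuleCat.of A M) (maximalIdeal_smul_top_lt_top M)
        (ModuleCat.of A (A ⧸ maximalIdeal A)) hsupp h
      exact natCast_le_depth_of_isRegular hmem hreg

/-- The depth lemma: `Ext^(i+1)` into the kernel sits between `Ext^i` into `N` and `Ext^(i+1)` into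
`M`. In degree zero, left exactness of `Hom` suffices. -/
theorem natCast_add_one_le_depth_ker {M N : Type u} [AddCommGroup M] [Module A M]
    [Module.Finite A M] [AddCommGroup N] [Module A N] (g : M →ₗ[A] N)
    (hg : Function.Surjective g) {n : ℕ} (hM : ((n + 1 : ℕ) : ℕ∞) ≤ depth A M)
    (hN : (n : ℕ∞) ≤ depth A N) : ((n + 1 : ℕ) : ℕ∞) ≤ depth A (LinearMap.ker g) := by
  have := Module.Finite.of_surjective g hg
  rw [natCast_le_depth_iff_ext] at *
  intro i hi
  let C : ShortComplex (ModuleCat.{u} A) :=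
    ShortComplex.mk (ModuleCat.ofHom (LinearMap.ker g).subtype) (ModuleCat.ofHom g) (by
      ext x; exact x.2)
  have hC : C.ShortExact := by
    refine ShortComplex.ShortExact.mk' ?_ ?_ ?_
    · rw [ShortComplex.moduleCat_exact_iff]
      intro x hx
      exact ⟨⟨x, hx⟩, rfl⟩
    · exact (ModuleCat.mono_iff_injective _).2 (LinearMap.ker g).subtype_injective
    · exact (ModuleCat.epi_iff_surjective _).2 hg
  have hM' := AddCommGrpCat.isZero_of_iff_subsingleton.mpr (hM i hi)
  rcases i with _ | i
  · have : Mono ((ModuleCat.ofHom (LinearMap.ker g).subtype)) := hC.mono_f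
    have h0 : Subsingleton (ModuleCat.of A (A ⧸ maximalIdeal A) ⟶ ModuleCat.of A M) :=
      (Ext.addEquiv₀.subsingleton_congr).mp (hM 0 hi)
    refine (Ext.addEquiv₀.subsingleton_congr).mpr ⟨fun a b => ?_⟩
    rw [← cancel_mono (ModuleCat.ofHom (LinearMap.ker g).subtype)]
    exact Subsingleton.elim _ _
  · have hN' := AddCommGrpCat.isZero_of_iff_subsingleton.mpr (hN i (by omega))
    exact AddCommGrpCat.subsingleton_of_isZero <| ShortComplex.Exact.isZero_of_both_zeros
      (Ext.covariant_sequence_exact₁' (ModuleCat.of A (A ⧸ maximalIdeal A)) hC i (i + 1) rfl)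
      (hN'.eq_zero_of_src _) (hM'.eq_zero_of_tgt _)

theorem natCast_le_depth_quotSMulTop {M : Type u} [AddCommGroup M] [Module A M]
    [Module.Finite A M] {x : A} (hx : IsSMulRegular M x) {n : ℕ}
    (hM : ((n + 1 : ℕ) : ℕ∞) ≤ depth A M) : (n : ℕ∞) ≤ depth A (QuotSMulTop x M) := by
  rw [natCast_le_depth_iff_ext] at *
  intro i hi
  have h1 := AddCommGrpCat.isZero_of_iff_subsingleton.mpr (hM i (by omega))
  have h2 := AddCommGrpCat.isZero_of_iff_subsingleton.mpr (hM (i + 1) (by omega))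
  exact AddCommGrpCat.subsingleton_of_isZero <| ShortComplex.Exact.isZero_of_both_zeros
    (Ext.covariant_sequence_exact₃' (ModuleCat.of A (A ⧸ maximalIdeal A))
      (IsSMulRegular.smulShortComplex_shortExact (M := ModuleCat.of A M) hx) i (i + 1) rfl)
    (h1.eq_zero_of_src _) (h2.eq_zero_of_tgt _)

end Depth

/-! ### Depth along surjective ring homomorphisms. -/

section Surjective

theorem depth_eq_of_surjective {A B : Type*} [CommRing A] [IsLocalRing A] [CommRing B]
    [Nontrivial B] {σ : A →+* B} (hσ : Function.Surjective σ) {M N : Type*} [AddCommGroup M]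
    [Module A M] [AddCommGroup N] [Module B N] (e : M ≃+ N) (he : ∀ a m, e (a • m) = σ a • e m) :
    depth A M = depth B N := by
  have := IsLocalRing.of_surjective' σ hσ
  have hloc : IsLocalHom σ := IsLocalHom.of_surjective σ hσ
  rcases subsingleton_or_nontrivial M with h | h
  · have : Subsingleton N := e.symm.injective.subsingleton
    simp [depth, h, this]
  have : Nontrivial N := e.symm.surjective.nontrivial
  refine ENat.eq_of_forall_natCast_le_iff fun n => ⟨fun hn => ?_, fun hn => ?_⟩
  · obtain ⟨rs, hlen, hmem, hreg⟩ := exists_isRegular_of_natCast_le_depth hn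
    refine le_trans (by simpa using hlen)
      (natCast_le_depth_of_isRegular (rs := rs.map σ) ?_ ((AddEquiv.isRegular_congr (e := e)
        (List.forall₂_map_right_iff.mpr (List.forall₂_same.mpr fun r _ x => he r x))).1 hreg))
    simp only [List.mem_map, forall_exists_index, and_imp, forall_apply_eq_imp_iff₂]
    exact fun r hr => (map_mem_nonunits_iff σ r).2 (hmem r hr)
  · obtain ⟨rs, hlen, hmem, hreg⟩ := exists_isRegular_of_natCast_le_depth hn
    obtain ⟨rs, rfl⟩ := List.map_surjective_iff.mpr hσ rs
    refine le_trans (by simpa using hlen)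
      (natCast_le_depth_of_isRegular (rs := rs) ?_ ((AddEquiv.isRegular_congr (e := e)
        (List.forall₂_map_right_iff.mpr (List.forall₂_same.mpr fun r _ x => he r x))).2 hreg))
    exact fun r hr => (map_mem_nonunits_iff σ r).1 (hmem _ (List.mem_map_of_mem hr))

end Surjective

/-! ### Modules of maximal depth over regular local rings are free. -/

section Free

theorem exists_isSMulRegular_of_one_le_depth {A : Type*} [CommRing A] [IsLocalRing A] {M : Type*}
    [AddCommGroup M] [Module A M] [Nontrivial M] {n : ℕ} (h : ((n + 1 : ℕ) : ℕ∞) ≤ depth A M) :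
    ∃ r ∈ maximalIdeal A, IsSMulRegular M r := by
  obtain ⟨rs, hlen, hmem, hreg⟩ := exists_isRegular_of_natCast_le_depth h
  match rs with
  | [] => simp at hlen
  | r :: rs => exact ⟨r, hmem r (by simp), ((isRegular_cons_iff M r rs).1 hreg).1⟩

theorem notMem_associatedPrime_of_isSMulRegular {A : Type*} [CommRing A] [IsNoetherianRing A]
    {M : Type*} [AddCommGroup M] [Module A M] {r : A} (hr : IsSMulRegular M r) {P : Ideal A}
    (hP : P ∈ associatedPrimes A M) : r ∉ P := fun h => by
  have : r ∈ ⋃ p ∈ associatedPrimes A M, (p : Set A) := Set.mem_biUnion hP h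
  rw [biUnion_associatedPrimes_eq_compl_regular] at this
  exact this hr

/-- Prime avoidance against the associated primes of `M` together with `maximalIdeal A ^ 2`, which
is allowed as the one nonprime ideal. -/
theorem exists_isSMulRegular_notMem_sq {A : Type*} [CommRing A] [IsLocalRing A]
    [IsNoetherianRing A] {M : Type*} [AddCommGroup M] [Module A M] [Module.Finite A M]
    [Nontrivial M] {r : A} (hr : r ∈ maximalIdeal A) (hreg : IsSMulRegular M r) :
    ∃ x ∈ maximalIdeal A, x ∉ maximalIdeal A ^ 2 ∧ IsSMulRegular M x := by
  by_contra! hcon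
  have hsub : (maximalIdeal A : Set A) ⊆
      ⋃ I ∈ insert (maximalIdeal A ^ 2) (associatedPrimes A M), (id I : Ideal A) := by
    intro x hx
    by_cases hx2 : x ∈ maximalIdeal A ^ 2
    · exact Set.mem_biUnion (Set.mem_insert _ _) hx2
    · have : x ∈ ⋃ p ∈ associatedPrimes A M, (p : Set A) := by
        rw [biUnion_associatedPrimes_eq_compl_regular]
        exact hcon x hx hx2
      obtain ⟨p, hp, hxp⟩ := Set.mem_iUnion₂.1 this
      exact Set.mem_biUnion (Set.mem_insert_of_mem _ hp) hxp
  obtain ⟨I, hI, hle⟩ := (Ideal.subset_union_prime_finite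
    ((associatedPrimes.finite A M).insert _) (maximalIdeal A ^ 2) (maximalIdeal A ^ 2)
    (fun I hI hne _ => (hI.resolve_left hne).isPrime)).1 hsub
  rcases hI with rfl | hI
  -- If the maximal ideal lies in its square, Nakayama makes it zero; then `r = 0`, which is not
  -- regular on a nonzero module.
  · have hbot : maximalIdeal A = ⊥ := by
      refine Submodule.eq_bot_of_le_smul_of_le_jacobson_bot (maximalIdeal A) _
        (IsNoetherian.noetherian _) ?_ (maximalIdeal_le_jacobson _)
      simpa [pow_two] using hle
    rw [hbot, Ideal.mem_bot] at hr
    subst hr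
    obtain ⟨m, hm⟩ := exists_ne (0 : M)
    exact hm (hreg (by simp))
  · exact notMem_associatedPrime_of_isSMulRegular hreg hI (hle hr)

/-- Since `x` is not in the square, some coefficient in an expression of `x` by the generators is a
unit; that generator becomes redundant modulo `x`. -/
theorem exists_card_span_maximalIdeal_quotient {A : Type*} [CommRing A] [IsLocalRing A] {x : A}
    (hx : x ∈ maximalIdeal A) (hx2 : x ∉ maximalIdeal A ^ 2) [IsLocalRing (A ⧸ Ideal.span {x})]
    {n : ℕ} {s : Finset A} (hs : s.card ≤ n + 1) (hspan : Ideal.span s = maximalIdeal A) :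
    ∃ t : Finset (A ⧸ Ideal.span {x}), t.card ≤ n ∧
      Ideal.span t = maximalIdeal (A ⧸ Ideal.span {x}) := by
  classical
  set π := Ideal.Quotient.mk (Ideal.span {x})
  have hπ : Function.Surjective π := Ideal.Quotient.mk_surjective
  obtain ⟨a, ha⟩ : ∃ a : A → A, ∑ t ∈ s, a t * t = x := by
    obtain ⟨a, -, ha⟩ := Submodule.mem_span_finset.1 (hspan ▸ hx : x ∈ Ideal.span (s : Set A))
    exact ⟨a, ha⟩
  obtain ⟨j, hj, hu⟩ : ∃ j ∈ s, IsUnit (a j) := by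
    by_contra! hcon
    refine hx2 (ha ▸ Ideal.sum_mem _ fun t ht => ?_)
    rw [pow_two]
    exact Ideal.mul_mem_mul (hcon t ht) (hspan ▸ Ideal.subset_span ht)
  obtain ⟨u, hu⟩ := hu
  refine ⟨(s.erase j).image π, Finset.card_image_le.trans ?_, ?_⟩
  · rw [Finset.card_erase_of_mem hj]; omega
  have hmap : maximalIdeal (A ⧸ Ideal.span {x}) = Ideal.span (π '' s) := by
    rw [← Ideal.map_span, hspan]
    exact (IsLocalRing.map_maximalIdeal_of_surjective π hπ).symm
  rw [hmap]
  refine le_antisymm (Ideal.span_mono ?_) (Ideal.span_le.2 ?_)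
  · rw [Finset.coe_image]
    exact Set.image_mono (Finset.coe_subset.2 (Finset.erase_subset _ _))
  rintro _ ⟨t, ht, rfl⟩
  by_cases htj : t = j
  · subst htj
    have hzero : π (∑ t ∈ s, a t * t) = 0 := by
      rw [ha]; exact Ideal.Quotient.eq_zero_iff_mem.2 (Ideal.mem_span_singleton_self x)
    rw [← Finset.add_sum_erase _ _ hj, map_add, map_mul, ← hu, add_eq_zero_iff_eq_neg] at hzero
    have : π t = π (↑u⁻¹ : A) * (π u * π t) := by
      rw [← mul_assoc, ← map_mul, Units.inv_mul, map_one, one_mul]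
    rw [this, hzero, map_sum]
    refine Ideal.mul_mem_left _ _ (neg_mem (Ideal.sum_mem _ fun i hi => ?_))
    rw [map_mul]
    exact Ideal.mul_mem_left _ _ (Ideal.subset_span (Finset.mem_coe.2 (Finset.mem_image_of_mem _ hi)))
  · exact Ideal.subset_span (by simpa using ⟨t, ⟨ht, htj⟩, rfl⟩)

theorem free_of_maximalIdeal_eq_bot {A : Type*} [CommRing A] [IsLocalRing A]
    (h : maximalIdeal A = ⊥) (M : Type*) [AddCommGroup M] [Module A M] : Module.Free A M :=
  letI : Field A := (IsLocalRing.isField_iff_maximalIdeal_eq.2 h).toField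
  Module.Free.of_divisionRing A M

/-- A finitely generated module over a Noetherian local ring whose depth is at least the number of
generators of the maximal ideal is free. -/
theorem free_of_natCast_le_depth (n : ℕ) : ∀ (A : Type u) [CommRing A] [IsLocalRing A]
    [IsNoetherianRing A] (s : Finset A), s.card ≤ n → Ideal.span s = maximalIdeal A →
    ∀ (M : Type u) [AddCommGroup M] [Module A M] [Module.Finite A M],
      (n : ℕ∞) ≤ depth A M → Module.Free A M := by
  induction n with
  | zero =>
    intro A _ _ _ s hs hspan M _ _ _ _
    refine free_of_maximalIdeal_eq_bot ?_ M
    rw [← hspan, Finset.card_eq_zero.1 (Nat.le_zero.1 hs)]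
    simp
  | succ n ih =>
    intro A _ _ _ s hs hspan M _ _ _ hdepth
    rcases subsingleton_or_nontrivial M with hM | hM
    · infer_instance
    obtain ⟨r, hr, hreg⟩ := exists_isSMulRegular_of_one_le_depth hdepth
    obtain ⟨x, hx, hx2, hreg⟩ := exists_isSMulRegular_notMem_sq hr hreg
    have : Nontrivial (A ⧸ Ideal.span {x}) := Ideal.Quotient.nontrivial_iff.2
      ((Ideal.span_singleton_le_iff_mem _).2 hx |>.trans_lt
        (IsLocalRing.maximalIdeal.isMaximal A).ne_top.lt_top).ne
    have : IsLocalRing (A ⧸ Ideal.span {x}) :=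
      IsLocalRing.of_surjective' _ Ideal.Quotient.mk_surjective
    obtain ⟨t, ht, htspan⟩ := exists_card_span_maximalIdeal_quotient hx hx2 hs hspan
    have := Module.Finite.of_restrictScalars_finite A (A ⧸ Ideal.span {x}) (QuotSMulTop x M)
    -- Dividing by `x` costs one generator of the maximal ideal and one unit of depth, so induction
    -- applies; freeness then lifts back along the regular element `x`.
    have hfree := ih (A ⧸ Ideal.span {x}) t ht htspan (QuotSMulTop x M) (by
      rw [← depth_eq_of_surjective (σ := Ideal.Quotient.mk (Ideal.span {x}))
        Ideal.Quotient.mk_surjective (AddEquiv.refl (QuotSMulTop x M)) fun a m => rfl]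
      exact natCast_le_depth_quotSMulTop hreg hdepth)
    have := Module.finitePresentation_of_finite A M
    exact (Module.free_quotSMulTop_iff_free A M
      (IsLocalRing.maximalIdeal_le_jacobson _ hx) hreg).1 hfree

end Free

/-! ### Depth over a finite local extension. -/

section FiniteExtension

variable {A B : Type u} [CommRing A] [IsLocalRing A] [CommRing B] [IsLocalRing B]
  [IsNoetherianRing B] [Algebra A B] [Module.Finite A B]

/-- Otherwise prime avoidance puts the maximal ideal of `A` in the contraction of an associated
prime `P`. By integrality `P` is then the maximal ideal of `B`, which contains the regular element
`r`. -/
theorem exists_isSMulRegular_algebraMap {M : Type*} [AddCommGroup M] [Module B M]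
    [Module.Finite B M] {r : B} (hr : r ∈ maximalIdeal B) (hreg : IsSMulRegular M r) :
    ∃ x ∈ maximalIdeal A, IsSMulRegular M (algebraMap A B x) := by
  by_contra! hcon
  have hsub : (maximalIdeal A : Set A) ⊆
      ⋃ P ∈ associatedPrimes B M, (P.comap (algebraMap A B) : Ideal A) := by
    intro x hx
    have : algebraMap A B x ∈ ⋃ p ∈ associatedPrimes B M, (p : Set B) := by
      rw [biUnion_associatedPrimes_eq_compl_regular]
      exact hcon x hx
    simpa using this
  obtain ⟨P, hP, hle⟩ := (Ideal.subset_union_prime_finite (associatedPrimes.finite B M) ⊥ ⊥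
    (fun P hP _ _ => have := hP.isPrime; Ideal.comap_isPrime _ P)).1 hsub
  have := hP.isPrime
  have hmax : (P.comap (algebraMap A B)).IsMaximal := by
    rw [← (IsLocalRing.maximalIdeal.isMaximal A).eq_of_le (Ideal.comap_isPrime _ P).ne_top hle]
    infer_instance
  have := Ideal.isMaximal_of_isIntegral_of_isMaximal_comap P hmax
  exact notMem_associatedPrime_of_isSMulRegular hreg hP
    (IsLocalRing.eq_maximalIdeal this ▸ hr)

theorem exists_isRegular_map_algebraMap {n : ℕ} (M : Type u) [AddCommGroup M] [Module B M]
    [Module.Finite B M] [Nontrivial M] [IsLocalHom (algebraMap A B)] (h : (n : ℕ∞) ≤ depth B M) :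
    ∃ rs : List A, rs.length = n ∧ (∀ r ∈ rs, r ∈ maximalIdeal A) ∧
      IsRegular M (rs.map (algebraMap A B)) := by
  induction n generalizing M with
  | zero => exact ⟨[], rfl, by simp, .nil B M⟩
  | succ n ih =>
    obtain ⟨r, hr, hreg⟩ := exists_isSMulRegular_of_one_le_depth h
    obtain ⟨x, hx, hxreg⟩ := exists_isSMulRegular_algebraMap (A := A) hr hreg
    have : Nontrivial (QuotSMulTop (algebraMap A B x) M) :=
      nontrivial_quotSMulTop_of_mem_maximalIdeal _ ((map_mem_nonunits_iff _ x).2 hx)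
    obtain ⟨rs, rfl, hmem, hrs⟩ := ih (QuotSMulTop (algebraMap A B x) M)
      (natCast_le_depth_quotSMulTop hxreg h)
    exact ⟨x :: rs, rfl, by simpa using ⟨hx, hmem⟩, hrs.cons hxreg⟩

theorem natCast_le_depth_of_finite_extension {n : ℕ} (M : Type u) [AddCommGroup M] [Module B M]
    [Module.Finite B M] [Module A M] [IsScalarTower A B M] [IsLocalHom (algebraMap A B)]
    (h : (n : ℕ∞) ≤ depth B M) : (n : ℕ∞) ≤ depth A M := by
  rcases subsingleton_or_nontrivial M with hM | hM
  · simp [depth, hM]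
  have : Module.Finite A M := Module.Finite.trans B M
  obtain ⟨rs, rfl, hmem, hreg⟩ := exists_isRegular_map_algebraMap (A := A) M h
  exact natCast_le_depth_of_isRegular hmem (.of_isWeaklyRegular_of_mem_maximalIdeal _ hmem
    ((isWeaklyRegular_map_algebraMap_iff B M rs).1 hreg.toIsWeaklyRegular))

end FiniteExtension

/-! ### Depth and dimension of power series rings. -/

section Quotient

/-- For a surjective ring homomorphism with principal kernel, its target as a quotient of the
source. -/
noncomputable def quotSMulTopEquivOfKerEq {A B : Type*} [CommRing A] [CommRing B] {σ : A →+* B}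
    (hσ : Function.Surjective σ) {x : A} (hker : RingHom.ker σ = Ideal.span {x}) :
    QuotSMulTop x A ≃+ B :=
  ((Submodule.quotEquivOfEq (x • ⊤ : Submodule A A) (RingHom.ker σ)
    (by rw [hker, ← Submodule.ideal_span_singleton_smul]; simp)).toAddEquiv).trans
    (RingHom.quotientKerEquivOfSurjective hσ).toAddEquiv

theorem depth_quotSMulTop_eq {A B : Type*} [CommRing A] [IsLocalRing A] [CommRing B]
    [Nontrivial B] {σ : A →+* B} (hσ : Function.Surjective σ) {x : A}
    (hker : RingHom.ker σ = Ideal.span {x}) : depth A (QuotSMulTop x A) = depth B B := by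
  refine depth_eq_of_surjective hσ (quotSMulTopEquivOfKerEq hσ hker) fun a m => ?_
  obtain ⟨m, rfl⟩ := Submodule.Quotient.mk_surjective _ m
  exact map_mul σ a m

end Quotient

section PowerSeries

variable (A : Type u) [CommRing A]

theorem isSMulRegular_X : IsSMulRegular (PowerSeries A) (PowerSeries.X : PowerSeries A) :=
  fun _ _ h => PowerSeries.X_mul_cancel h

theorem ker_constantCoeff : RingHom.ker (PowerSeries.constantCoeff (R := A)) =
    Ideal.span {PowerSeries.X} := by
  ext p
  rw [RingHom.mem_ker, Ideal.mem_span_singleton, PowerSeries.X_dvd_iff]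

theorem constantCoeff_surjective : Function.Surjective (PowerSeries.constantCoeff (R := A)) :=
  fun a => ⟨PowerSeries.C a, by simp⟩

variable [IsLocalRing A]

theorem X_mem_maximalIdeal : (PowerSeries.X : PowerSeries A) ∈ maximalIdeal (PowerSeries A) := by
  rw [mem_maximalIdeal, mem_nonunits_iff, PowerSeries.isUnit_iff_constantCoeff]
  simp

theorem natCast_add_one_le_depth_powerSeries {n : ℕ} (h : (n : ℕ∞) ≤ depth A A) :
    ((n + 1 : ℕ) : ℕ∞) ≤ depth (PowerSeries A) (PowerSeries A) := by
  refine natCast_add_one_le_depth_of_quotSMulTop (X_mem_maximalIdeal A) (isSMulRegular_X A) ?_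
  rwa [depth_quotSMulTop_eq (constantCoeff_surjective A) (ker_constantCoeff A)]

theorem ringKrullDim_powerSeries_eq [IsNoetherianRing A] :
    ringKrullDim (PowerSeries A) = ringKrullDim A + 1 := by
  rw [← ringKrullDim_quotient_span_singleton_succ_eq_ringKrullDim (isSMulRegular_X A)
    (X_mem_maximalIdeal A)]
  congr 1
  exact ringKrullDim_eq_of_ringEquiv ((Ideal.quotEquivOfEq (ker_constantCoeff A).symm).trans
    (RingHom.quotientKerEquivOfSurjective (constantCoeff_surjective A)))

end PowerSeries

/-! ### Power series over a field as a complete regular local ring. -/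

section MvPowerSeries

variable (k : Type u) [Field k]

theorem natCast_le_depth_mvPowerSeries (n : ℕ) :
    (n : ℕ∞) ≤ depth (MvPowerSeries (Fin n) k) (MvPowerSeries (Fin n) k) := by
  induction n with
  | zero => simp
  | succ n ih =>
    rw [depth_eq_of_surjective (σ := (MvPowerSeries.finSuccEquiv k n).toRingEquiv.toRingHom)
      (MvPowerSeries.finSuccEquiv k n).surjective
      (MvPowerSeries.finSuccEquiv k n).toRingEquiv.toAddEquiv
      fun a m => map_mul (MvPowerSeries.finSuccEquiv k n) a m]
    exact natCast_add_one_le_depth_powerSeries _ ih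

theorem ringKrullDim_mvPowerSeries (n : ℕ) :
    ringKrullDim (MvPowerSeries (Fin n) k) = n := by
  induction n with
  | zero =>
    rw [ringKrullDim_eq_of_ringEquiv (MvPowerSeries.isEmptyEquiv (Fin 0) k).toRingEquiv]
    simp
  | succ n ih =>
    rw [ringKrullDim_eq_of_ringEquiv (MvPowerSeries.finSuccEquiv k n).toRingEquiv,
      ringKrullDim_powerSeries_eq, ih]
    simp

theorem mem_span_range_X (n : ℕ) (f : MvPowerSeries (Fin n) k)
    (hf : MvPowerSeries.constantCoeff f = 0) :
    f ∈ Ideal.span (Set.range (MvPowerSeries.X : Fin n → MvPowerSeries (Fin n) k)) := by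
  induction n with
  | zero =>
    have : f = 0 := by
      ext x
      rw [Subsingleton.elim x 0]
      simpa using hf
    rw [this]
    exact zero_mem _
  | succ n ih =>
    set e := MvPowerSeries.finSuccEquiv k n
    have h0 : MvPowerSeries.constantCoeff (PowerSeries.constantCoeff (e f)) = 0 := by
      rw [← PowerSeries.coeff_zero_eq_constantCoeff_apply,
        ← MvPowerSeries.coeff_zero_eq_constantCoeff_apply,
        MvPowerSeries.coeff_coeff_finSuccEquiv, Finsupp.cons_zero_zero]
      simpa using hf
    -- Split `f` into its part free of the variable `X 0`, handled by induction, and a multiple of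
    -- `X 0`.
    obtain ⟨q, hq⟩ : (PowerSeries.X : PowerSeries (MvPowerSeries (Fin n) k)) ∣
        e f - PowerSeries.C (PowerSeries.constantCoeff (e f)) := by
      rw [PowerSeries.X_dvd_iff]; simp
    have hfe : f = e.symm (PowerSeries.C (PowerSeries.constantCoeff (e f))) +
        MvPowerSeries.X 0 * e.symm q := by
      apply e.injective
      rw [map_add, map_mul, AlgEquiv.apply_symm_apply, AlgEquiv.apply_symm_apply,
        MvPowerSeries.finSuccEquiv_X_zero, ← hq]
      ring
    rw [hfe]
    refine add_mem ?_ (Ideal.mul_mem_right _ _ (Ideal.subset_span ⟨0, rfl⟩))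
    have hmem := Ideal.mem_map_of_mem
      ((e.symm.toRingEquiv.toRingHom).comp PowerSeries.C) (ih _ h0)
    rw [Ideal.map_span] at hmem
    refine Ideal.span_mono ?_ hmem
    rintro _ ⟨_, ⟨i, rfl⟩, rfl⟩
    refine ⟨i.succ, ?_⟩
    exact e.injective (by simp [e])

theorem span_range_X_eq_maximalIdeal (n : ℕ) :
    Ideal.span (Set.range (MvPowerSeries.X : Fin n → MvPowerSeries (Fin n) k)) =
      maximalIdeal (MvPowerSeries (Fin n) k) := by
  refine le_antisymm (Ideal.span_le.2 ?_) fun f hf => ?_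
  · rintro _ ⟨i, rfl⟩
    rw [SetLike.mem_coe, mem_maximalIdeal, mem_nonunits_iff,
      MvPowerSeries.isUnit_iff_constantCoeff]
    simp
  · refine mem_span_range_X k n f ?_
    rwa [mem_maximalIdeal, mem_nonunits_iff, MvPowerSeries.isUnit_iff_constantCoeff,
      isUnit_iff_ne_zero, not_not] at hf

instance isAdicComplete_maximalIdeal_mvPowerSeries (n : ℕ) :
    IsAdicComplete (maximalIdeal (MvPowerSeries (Fin n) k)) (MvPowerSeries (Fin n) k) := by
  rw [← span_range_X_eq_maximalIdeal]
  infer_instance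

/-- A module over a power series ring over a field whose depth is at least the number of variables
is free. -/
theorem free_mvPowerSeries_of_natCast_le_depth (n : ℕ) (M : Type u) [AddCommGroup M]
    [Module (MvPowerSeries (Fin n) k) M] [Module.Finite (MvPowerSeries (Fin n) k) M]
    (h : (n : ℕ∞) ≤ depth (MvPowerSeries (Fin n) k) M) :
    Module.Free (MvPowerSeries (Fin n) k) M := by
  classical
  refine free_of_natCast_le_depth n _ (Finset.univ.image MvPowerSeries.X)
    (Finset.card_image_le.trans (by simp)) ?_ M h
  rw [← span_range_X_eq_maximalIdeal]
  simp

end MvPowerSeries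

/-! ### Ring structure of the double branched cover. -/

section BranchedCover

variable {S : Type u} [CommRing S]

/-- Weierstrass division by `f + z²`, which reduces to `z²` over the residue field, leaves a
remainder of degree less than two. -/
theorem exists_eq_add_mul_zVar [IsLocalRing S] [IsAdicComplete (maximalIdeal S) S] {f : S}
    (hf : f ∈ maximalIdeal S) (b : BranchedCover f) :
    ∃ s t : S, b = algebraMap S (BranchedCover f) s + algebraMap S (BranchedCover f) t * zVar f := by
  obtain ⟨p, rfl⟩ := Ideal.Quotient.mk_surjective b
  set g : PowerSeries S := PowerSeries.C f + PowerSeries.X ^ 2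
  have hg : g.map (residue S) = PowerSeries.X ^ 2 := by
    simp [g, (residue_eq_zero_iff f).2 hf]
  obtain ⟨q, r, hdiv⟩ := PowerSeries.exists_isWeierstrassDivision p
    (g := g) (by rw [hg]; exact pow_ne_zero _ PowerSeries.X_ne_zero)
  have hdeg : r.degree < (2 : ℕ) := by
    have := hdiv.degree_lt
    rwa [show g.map (Ideal.Quotient.mk (maximalIdeal S)) = PowerSeries.X ^ 2 from hg,
      PowerSeries.order_X_pow] at this
  refine ⟨r.coeff 0, r.coeff 1, ?_⟩
  have hr : (r : PowerSeries S) = PowerSeries.C (r.coeff 0) +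
      PowerSeries.C (r.coeff 1) * PowerSeries.X := by
    rw [Polynomial.eq_X_add_C_of_degree_le_one (p := r) (Order.le_of_lt_succ hdeg)]
    simp [add_comm]
  rw [hdiv.eq_mul_add, hr, map_add, map_mul, Ideal.Quotient.eq_zero_iff_mem.2
    (Ideal.mem_span_singleton_self g), zero_mul, zero_add, map_add, map_mul]
  rfl

theorem zVar_mul_self (f : S) :
    zVar f * zVar f = -algebraMap S (BranchedCover f) f := by
  rw [eq_neg_iff_add_eq_zero, zVar, ← map_mul]
  change Ideal.Quotient.mk _ _ + Ideal.Quotient.mk _ (PowerSeries.C f) = 0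
  rw [← map_add, Ideal.Quotient.eq_zero_iff_mem, Ideal.mem_span_singleton]
  exact ⟨1, by ring⟩

theorem finite_branchedCover [IsLocalRing S] [IsAdicComplete (maximalIdeal S) S] {f : S}
    (hf : f ∈ maximalIdeal S) : Module.Finite S (BranchedCover f) := by
  classical
  refine ⟨⟨{1, zVar f}, eq_top_iff.2 fun b _ => ?_⟩⟩
  obtain ⟨s, t, rfl⟩ := exists_eq_add_mul_zVar hf b
  rw [← Algebra.smul_def, Algebra.algebraMap_eq_smul_one]
  exact add_mem (Submodule.smul_mem _ _ (Submodule.subset_span (by simp)))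
    (Submodule.smul_mem _ _ (Submodule.subset_span (by simp)))

theorem nontrivial_hypersurface [IsLocalRing S] {f : S} (hf : f ∈ maximalIdeal S) :
    Nontrivial (Hypersurface f) :=
  Ideal.Quotient.nontrivial_iff.2 (((Ideal.span_singleton_le_iff_mem _).2 hf).trans_lt
    (maximalIdeal.isMaximal S).ne_top.lt_top).ne

theorem C_add_X_sq_mem_maximalIdeal [IsLocalRing S] {f : S} (hf : f ∈ maximalIdeal S) :
    (PowerSeries.C f + PowerSeries.X ^ 2 : PowerSeries S) ∈ maximalIdeal (PowerSeries S) := by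
  rw [mem_maximalIdeal, mem_nonunits_iff, PowerSeries.isUnit_iff_constantCoeff]
  simpa using hf

theorem C_add_X_sq_ne_zero [Nontrivial S] (f : S) :
    (PowerSeries.C f + PowerSeries.X ^ 2 : PowerSeries S) ≠ 0 := fun h => by
  have := congrArg (PowerSeries.coeff 2) h
  simp [PowerSeries.coeff_X_pow] at this

theorem toHypersurface_surjective (f : S) : Function.Surjective (toHypersurface f) := by
  intro r
  obtain ⟨s, rfl⟩ := Ideal.Quotient.mk_surjective r
  exact ⟨Ideal.Quotient.mk _ (PowerSeries.C s), by simp [toHypersurface]⟩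

theorem nontrivial_branchedCover [IsLocalRing S] {f : S} (hf : f ∈ maximalIdeal S) :
    Nontrivial (BranchedCover f) :=
  have := nontrivial_hypersurface hf
  (toHypersurface f).domain_nontrivial

theorem isLocalRing_branchedCover [IsLocalRing S] {f : S} (hf : f ∈ maximalIdeal S) :
    IsLocalRing (BranchedCover f) :=
  have := nontrivial_branchedCover hf
  IsLocalRing.of_surjective' _ Ideal.Quotient.mk_surjective

theorem isLocalHom_algebraMap_branchedCover [IsLocalRing S] {f : S} (hf : f ∈ maximalIdeal S) :
    IsLocalHom (algebraMap S (BranchedCover f)) := by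
  have := nontrivial_hypersurface hf
  refine ⟨fun s hs => ?_⟩
  have hs : IsUnit (Ideal.Quotient.mk (Ideal.span {f}) s) := by
    have h := hs.map (toHypersurface f)
    change IsUnit (toHypersurface f (Ideal.Quotient.mk _ (PowerSeries.C s))) at h
    simpa [toHypersurface] using h
  have := IsLocalHom.of_surjective (Ideal.Quotient.mk (Ideal.span {f}))
    Ideal.Quotient.mk_surjective
  exact isUnit_of_map_unit _ s hs

theorem isSMulRegular_self_of_ne_zero {A : Type*} [CommRing A] [IsDomain A] {x : A} (hx : x ≠ 0) :
    IsSMulRegular A x :=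
  fun _ _ h => mul_left_cancel₀ hx h

variable [IsLocalRing S] [IsNoetherianRing S] [IsDomain S]

theorem ringKrullDim_hypersurface_add_one {f : S} (hf : f ∈ maximalIdeal S) (hf0 : f ≠ 0) :
    ringKrullDim (Hypersurface f) + 1 = ringKrullDim S :=
  ringKrullDim_quotient_span_singleton_succ_eq_ringKrullDim (isSMulRegular_self_of_ne_zero hf0) hf

theorem ringKrullDim_branchedCover_add_one {f : S} (hf : f ∈ maximalIdeal S) :
    ringKrullDim (BranchedCover f) + 1 = ringKrullDim S + 1 := by
  rw [← ringKrullDim_powerSeries_eq S]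
  exact ringKrullDim_quotient_span_singleton_succ_eq_ringKrullDim
    (isSMulRegular_self_of_ne_zero (C_add_X_sq_ne_zero f)) (C_add_X_sq_mem_maximalIdeal hf)

theorem natCast_le_depth_branchedCover {f : S} (hf : f ∈ maximalIdeal S) {n : ℕ}
    (h : (n : ℕ∞) ≤ depth S S) : (n : ℕ∞) ≤ depth (BranchedCover f) (BranchedCover f) := by
  have := isLocalRing_branchedCover hf
  refine le_of_le_of_eq (natCast_le_depth_quotSMulTop
    (isSMulRegular_self_of_ne_zero (C_add_X_sq_ne_zero f))
    (natCast_add_one_le_depth_powerSeries S h)) (depth_quotSMulTop_eq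
      (σ := Ideal.Quotient.mk (Ideal.span {(PowerSeries.C f + PowerSeries.X ^ 2 : PowerSeries S)}))
      Ideal.Quotient.mk_surjective Ideal.mk_ker)

end BranchedCover

/-! ### Factorizations through free modules. -/

section Stable

variable {R : Type u} [CommRing R]

theorem exists_lift_of_injective {M N L : Type*} [AddCommGroup M] [Module R M] [AddCommGroup N]
    [Module R N] [AddCommGroup L] [Module R L] (i : M →ₗ[R] N) (hi : Function.Injective i)
    (h : L →ₗ[R] N) (hr : ∀ x, ∃ y, i y = h x) : ∃ l : L →ₗ[R] M, ∀ x, i (l x) = h x := by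
  refine ⟨(LinearEquiv.ofInjective i hi).symm.toLinearMap ∘ₗ
    h.codRestrict (LinearMap.range i) hr, fun x => ?_⟩
  have := LinearEquiv.apply_symm_apply (LinearEquiv.ofInjective i hi)
    (h.codRestrict (LinearMap.range i) hr x)
  exact congrArg Subtype.val this

theorem exists_lift_of_surjective {P M N : Type*} [AddCommGroup P] [Module R P]
    [Module.Projective R P] [AddCommGroup M] [Module R M] [AddCommGroup N] [Module R N]
    (p : M →ₗ[R] N) (hp : Function.Surjective p) (h : P →ₗ[R] N) :
    ∃ l : P →ₗ[R] M, ∀ x, p (l x) = h x := by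
  obtain ⟨l, hl⟩ := Module.projective_lifting_property p h hp
  exact ⟨l, fun x => LinearMap.congr_fun hl x⟩

variable {M N : Type u} [AddCommGroup M] [Module R M] [AddCommGroup N] [Module R N]

theorem comp_mem_projMaps {n : ℕ} (a : M →ₗ[R] (Fin n → R)) (b : (Fin n → R) →ₗ[R] N) :
    b ∘ₗ a ∈ projMaps R M N :=
  ⟨ULift.{u} (Fin n) → R, inferInstance, inferInstance, inferInstance, inferInstance,
    (LinearEquiv.funCongrLeft R R Equiv.ulift).toLinearMap ∘ₗ a,
    b ∘ₗ (LinearEquiv.funCongrLeft R R Equiv.ulift).symm.toLinearMap, by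
      ext x; simp; rfl⟩

theorem exists_fin_of_mem_projMaps {h : M →ₗ[R] N} (hh : h ∈ projMaps R M N) :
    ∃ (n : ℕ) (a : M →ₗ[R] (Fin n → R)) (b : (Fin n → R) →ₗ[R] N), h = b ∘ₗ a := by
  obtain ⟨P, _, _, _, _, a, b, rfl⟩ := hh
  obtain ⟨n, p, s, -, -, hps⟩ := Module.Finite.exists_comp_eq_id_of_projective R P
  refine ⟨n, s ∘ₗ a, b ∘ₗ p, ?_⟩
  ext x
  exact congrArg b (LinearMap.congr_fun hps (a x)).symm

theorem map_eq_sum_single {n : ℕ} {N : Type*} [AddCommGroup N] [Module R N]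
    (b : (Fin n → R) →ₗ[R] N) (v : Fin n → R) : b v = ∑ i, v i • b (Pi.single i 1) := by
  conv_lhs => rw [pi_eq_sum_univ' v, map_sum]
  exact Finset.sum_congr rfl fun i _ => map_smul b _ _

theorem stableAnn_le_of_leftInverse (s : N →ₗ[R] M) (r : M →ₗ[R] N) (h : ∀ x, r (s x) = x) :
    stableAnn R M ≤ stableAnn R N := by
  intro c hc
  rw [mem_stableAnn_iff] at hc ⊢
  convert projMaps_comp hc s r using 1
  ext x
  simp [h]

end Stable

/-! ### Stable annihilators of reductions and syzygies. -/

section Branched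

variable {S : Type u} [CommRing S] (f : S)

theorem toHypersurface_mk (p : PowerSeries S) :
    toHypersurface f (Ideal.Quotient.mk _ p) =
      Ideal.Quotient.mk _ (PowerSeries.constantCoeff p) := rfl

theorem toHypersurface_zVar : toHypersurface f (zVar f) = 0 := by
  rw [zVar, toHypersurface_mk, PowerSeries.constantCoeff_X, map_zero]

instance : RingHomSurjective (toHypersurface f) := ⟨toHypersurface_surjective f⟩

theorem fromHypersurface_toHypersurface (b : BranchedCover f) :
    fromHypersurface f (toHypersurface f b) = Ideal.Quotient.mk (Ideal.span {zVar f}) b := by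
  obtain ⟨p, rfl⟩ := Ideal.Quotient.mk_surjective b
  obtain ⟨q, hq⟩ : PowerSeries.X ∣ p - PowerSeries.C (PowerSeries.constantCoeff p) := by
    rw [PowerSeries.X_dvd_iff]; simp
  rw [toHypersurface_mk]
  change Ideal.Quotient.mk _ (Ideal.Quotient.mk _ (PowerSeries.C _)) = _
  rw [eq_comm, Ideal.Quotient.eq, ← map_sub, hq, map_mul]
  exact Ideal.mul_mem_right _ _ (Ideal.mem_span_singleton_self _)

/-- The map `a₀ + a₁ z ↦ a₁` from `R^♯` to `R`, a derivation over `R^♯ → R`. -/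
noncomputable def zCoeff : BranchedCover f →+ Hypersurface f :=
  QuotientAddGroup.lift
    (Ideal.span {(PowerSeries.C f + PowerSeries.X ^ 2 : PowerSeries S)}).toAddSubgroup
    (((Ideal.Quotient.mk (Ideal.span {f}) : S →+* Hypersurface f) : S →+ Hypersurface f).comp
      ((PowerSeries.coeff (R := S) 1 : PowerSeries S →ₗ[S] S) : PowerSeries S →+ S)) (by
    intro p hp
    obtain ⟨q, rfl⟩ := Ideal.mem_span_singleton.1 (show p ∈ Ideal.span _ from hp)
    -- The `z`-coefficient of `(f + z²) q` is `f` times that of `q`, so it dies in `R`.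
    refine Ideal.Quotient.eq_zero_iff_mem.2 (Ideal.mem_span_singleton.2
      ⟨PowerSeries.coeff 1 q, ?_⟩)
    change (PowerSeries.coeff (R := S) 1) ((PowerSeries.C f + PowerSeries.X ^ 2) * q) = _
    rw [add_mul, map_add, PowerSeries.coeff_C_mul, PowerSeries.coeff_X_pow_mul']
    simp)

theorem zCoeff_mk (p : PowerSeries S) : zCoeff f (Ideal.Quotient.mk _ p) =
    Ideal.Quotient.mk _ (PowerSeries.coeff 1 p) := rfl

theorem zCoeff_zVar : zCoeff f (zVar f) = 1 := by
  rw [zVar, zCoeff_mk, PowerSeries.coeff_one_X, map_one]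

theorem zCoeff_mul (a b : BranchedCover f) : zCoeff f (a * b) =
    zCoeff f a * toHypersurface f b + toHypersurface f a * zCoeff f b := by
  obtain ⟨p, rfl⟩ := Ideal.Quotient.mk_surjective a
  obtain ⟨q, rfl⟩ := Ideal.Quotient.mk_surjective b
  rw [← map_mul]
  simp only [zCoeff_mk, toHypersurface_mk, ← map_mul, ← map_add]
  congr 1
  rw [PowerSeries.coeff_mul, Finset.Nat.antidiagonal_succ]
  simp [add_comm]

/-- If `z p = (f + z²) q`, then constant terms give `f q₀ = 0`; hence `z` divides `q` and can be
cancelled. -/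
theorem zVar_mul_cancel [IsDomain S] (hf0 : f ≠ 0) {b : BranchedCover f} (h : zVar f * b = 0) :
    b = 0 := by
  obtain ⟨p, rfl⟩ := Ideal.Quotient.mk_surjective b
  rw [zVar, ← map_mul, Ideal.Quotient.eq_zero_iff_mem, Ideal.mem_span_singleton] at h
  obtain ⟨q, hq⟩ := h
  have h0 : PowerSeries.constantCoeff q = 0 := by
    have := congrArg PowerSeries.constantCoeff hq
    simpa [hf0] using this
  obtain ⟨q, rfl⟩ := PowerSeries.X_dvd_iff.2 h0
  rw [Ideal.Quotient.eq_zero_iff_mem, Ideal.mem_span_singleton]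
  exact ⟨q, PowerSeries.X_mul_cancel (hq.trans (by ring))⟩

/-- The identity `Res N → N`, which is semilinear over `R^♯ → R`. -/
def Res.val {N : Type u} [AddCommGroup N] [Module (Hypersurface f) N] :
    Res f N →ₛₗ[toHypersurface f] N where
  toFun x := x
  map_add' _ _ := rfl
  map_smul' _ _ := rfl

variable {f}

/-- A map semilinear over `R^♯ → R`, as an `R^♯`-linear map. -/
noncomputable def Res.lift {M N : Type u} [AddCommGroup M] [Module (BranchedCover f) M] [AddCommGroup N]
    [Module (Hypersurface f) N] (φ : M →ₛₗ[toHypersurface f] N) :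
    M →ₗ[BranchedCover f] Res f N where
  toFun x := φ x
  map_add' := φ.map_add
  map_smul' := φ.map_smulₛₗ

theorem Res.zVar_smul {N : Type u} [AddCommGroup N] [Module (Hypersurface f) N] (x : Res f N) :
    zVar f • x = 0 := by
  change toHypersurface f (zVar f) • Res.val f x = 0
  rw [toHypersurface_zVar, zero_smul]

section ModZ

variable (f)
variable (M : Type u) [AddCommGroup M] [Module (BranchedCover f) M]

/-- The projection `M → M/zM`. -/
noncomputable def ModZ.mk : M →ₛₗ[toHypersurface f] ModZ f M where
  toFun m := Submodule.Quotient.mk m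
  map_add' _ _ := rfl
  map_smul' b m := by
    have key : ∀ c, c = Ideal.Quotient.mk (Ideal.span {zVar f}) b →
        (Submodule.Quotient.mk (b • m) :
          M ⧸ (Ideal.span {zVar f} • ⊤ : Submodule (BranchedCover f) M)) =
        (c • Submodule.Quotient.mk m :
          M ⧸ (Ideal.span {zVar f} • ⊤ : Submodule (BranchedCover f) M)) := by
      rintro _ rfl
      rfl
    exact key _ (fromHypersurface_toHypersurface f b)

variable {M}

theorem ModZ.mk_surjective : Function.Surjective (ModZ.mk f M) := Submodule.Quotient.mk_surjective _

theorem ModZ.mk_eq_zero_iff {m : M} : ModZ.mk f M m = 0 ↔ ∃ m', zVar f • m' = m := by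
  change (Submodule.Quotient.mk m : M ⧸ (Ideal.span {zVar f} • ⊤ : Submodule _ M)) = 0 ↔ _
  rw [Submodule.Quotient.mk_eq_zero, Submodule.ideal_span_singleton_smul,
    Submodule.mem_smul_pointwise_iff_exists]
  simp

variable {f}

/-- The map `M/zM → N` induced by a map `M → N` to an `R`-module. -/
noncomputable def ModZ.lift {N : Type u} [AddCommGroup N] [Module (Hypersurface f) N]
    (φ : M →ₛₗ[toHypersurface f] N) : ModZ f M →ₗ[Hypersurface f] N where
  toFun := Submodule.liftQ (Ideal.span {zVar f} • ⊤ : Submodule (BranchedCover f) M) φ (by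
    rw [Submodule.ideal_span_singleton_smul]
    rintro _ ⟨m, -, rfl⟩
    change φ (zVar f • m) = 0
    rw [map_smulₛₗ, toHypersurface_zVar, zero_smul])
  map_add' := map_add _
  map_smul' r x := by
    obtain ⟨b, rfl⟩ := toHypersurface_surjective f r
    obtain ⟨m, rfl⟩ := ModZ.mk_surjective f x
    rw [← map_smulₛₗ]
    exact map_smulₛₗ φ b m

theorem ModZ.lift_mk {N : Type u} [AddCommGroup N] [Module (Hypersurface f) N]
    (φ : M →ₛₗ[toHypersurface f] N) (m : M) : ModZ.lift φ (ModZ.mk f M m) = φ m := rfl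

theorem stableAnn_le_comap_stableAnn_modZ :
    stableAnn (BranchedCover f) M ≤
      (stableAnn (Hypersurface f) (ModZ f M)).comap (toHypersurface f) := by
  intro c hc
  rw [Ideal.mem_comap]
  rw [mem_stableAnn_iff] at hc ⊢
  obtain ⟨n, a, b, hab⟩ := exists_fin_of_mem_projMaps hc
  let a' : M →ₛₗ[toHypersurface f] (Fin n → Hypersurface f) :=
    { toFun := fun m i => toHypersurface f (a m i)
      map_add' := fun x y => by ext i; simp
      map_smul' := fun r x => by ext i; simp }
  let b' : (Fin n → Hypersurface f) →ₗ[Hypersurface f] ModZ f M :=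
    Fintype.linearCombination (Hypersurface f) fun i => ModZ.mk f M (b (Pi.single i 1))
  convert comp_mem_projMaps (ModZ.lift a') b' using 1
  ext x
  obtain ⟨m, rfl⟩ := ModZ.mk_surjective f x
  have hm : c • m = ∑ i, a m i • b (Pi.single i 1) := by
    have h1 : c • m = b (a m) := LinearMap.congr_fun hab m
    rw [h1]
    exact map_eq_sum_single b (a m)
  rw [LinearMap.smul_apply, LinearMap.id_apply, LinearMap.comp_apply, ModZ.lift_mk,
    ← map_smulₛₗ, hm, map_sum, Fintype.linearCombination_apply]
  exact Finset.sum_congr rfl fun i _ => map_smulₛₗ _ _ _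

end ModZ

section Syzygy

variable {N : Type u} [AddCommGroup N] [Module (Hypersurface f) N] {n : ℕ}
  (g : (Fin n → BranchedCover f) →ₗ[BranchedCover f] Res f N)

/-- The map `Ω N → N` sending `a₀ + a₁ z`, where `a₀` and `a₁` have entries in `S`, to the value
of `R^♯ⁿ → N` at `a₁`. -/
noncomputable def syzygyRetraction : LinearMap.ker g →ₛₗ[toHypersurface f] N where
  toFun x := ∑ i, zCoeff f (x.1 i) • Res.val f (g (Pi.single i 1))
  map_add' x y := by simp [add_smul, Finset.sum_add_distrib]
  map_smul' b x := by
    -- By the Leibniz rule for `zCoeff`, semilinearity fails by a multiple of this sum, which is `g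
    -- x` and so vanishes on the kernel.
    have hx : ∑ i, toHypersurface f (x.1 i) • Res.val f (g (Pi.single i 1)) = 0 := by
      have h := congrArg (Res.val f) x.2
      rw [map_zero, pi_eq_sum_univ' x.1, map_sum, map_sum] at h
      simpa using h
    have h : ∀ i, zCoeff f ((b • x).1 i) • Res.val f (g (Pi.single i 1)) =
        zCoeff f b • (toHypersurface f (x.1 i) • Res.val f (g (Pi.single i 1))) +
          toHypersurface f b • (zCoeff f (x.1 i) • Res.val f (g (Pi.single i 1))) := fun i => by
      rw [smul_smul, smul_smul, ← add_smul, ← zCoeff_mul]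
      rfl
    rw [Finset.sum_congr rfl fun i _ => h i, Finset.sum_add_distrib, ← Finset.smul_sum,
      ← Finset.smul_sum, hx, smul_zero, zero_add]

theorem syzygyRetraction_zVar_smul (x : Fin n → BranchedCover f)
    (hx : zVar f • x ∈ LinearMap.ker g) :
    syzygyRetraction g ⟨zVar f • x, hx⟩ = Res.val f (g x) := by
  change ∑ i, zCoeff f (zVar f * x i) • Res.val f (g (Pi.single i 1)) = _
  conv_rhs => rw [pi_eq_sum_univ' x, map_sum, map_sum]
  refine Finset.sum_congr rfl fun i _ => ?_
  rw [zCoeff_mul, zCoeff_zVar, toHypersurface_zVar]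
  simp

theorem zVar_smul_mem_ker (x : Fin n → BranchedCover f) : zVar f • x ∈ LinearMap.ker g := by
  rw [LinearMap.mem_ker, map_smul, Res.zVar_smul]

variable {g}

/-- The section sends `y` to the class of `z x` for any lift `x` of `y`: two lifts differ by an
element of the kernel, so their multiples by `z` agree modulo `z ΩN`. -/
theorem exists_section_syzygyRetraction (hg : Function.Surjective g) :
    ∃ s : N →ₗ[Hypersurface f] ModZ f (LinearMap.ker g),
      ∀ x, ModZ.lift (syzygyRetraction g) (s x) = x := by
  let t : (Fin n → BranchedCover f) →ₗ[BranchedCover f] LinearMap.ker g :=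
    ((LinearMap.lsmul (BranchedCover f) (Fin n → BranchedCover f)) (zVar f)).codRestrict _
      (zVar_smul_mem_ker g)
  let t' := (ModZ.mk f (LinearMap.ker g)).comp t
  have ht : ∀ x y, g x = g y → t' x = t' y := fun x y h => by
    rw [← sub_eq_zero, ← map_sub]
    refine (ModZ.mk_eq_zero_iff f).2 ⟨⟨x - y, by simp [h]⟩, rfl⟩
  choose c hc using fun y : N => hg (y : Res f N)
  refine ⟨{ toFun := fun y => t' (c y), map_add' := fun y z => ?_, map_smul' := fun r y => ?_ },
    fun y => ?_⟩
  · rw [← map_add]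
    refine ht _ _ ?_
    rw [map_add, hc, hc, hc]
    rfl
  · obtain ⟨b, rfl⟩ := toHypersurface_surjective f r
    rw [RingHom.id_apply, ← map_smulₛₗ]
    refine ht _ _ ?_
    rw [map_smul, hc, hc]
    rfl
  · change syzygyRetraction g ⟨zVar f • c y, zVar_smul_mem_ker g _⟩ = y
    rw [syzygyRetraction_zVar_smul, hc]
    rfl

/-- Lift a factorization `β α` of `c • id` on `N` to maps `A`, `B` of free `R♯`-modules. Then `c - B
A` maps the free module into `K`, while on `K` one has `A = z A'` and `B z` lands in `K`. So `c = (c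
- B A) + (B z) A'` on `K`, a sum of two maps through free modules. -/
theorem comap_stableAnn_le_stableAnn_ker [IsDomain S] (hf0 : f ≠ 0)
    (hg : Function.Surjective g) :
    (stableAnn (Hypersurface f) N).comap (toHypersurface f) ≤
      stableAnn (BranchedCover f) (LinearMap.ker g) := by
  intro c hc
  rw [Ideal.mem_comap] at hc
  rw [mem_stableAnn_iff] at hc ⊢
  obtain ⟨m, α, β, hαβ⟩ := exists_fin_of_mem_projMaps hc
  let π : (Fin m → BranchedCover f) →ₛₗ[toHypersurface f] (Fin m → Hypersurface f) :=
    { toFun := fun x i => toHypersurface f (x i)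
      map_add' := fun x y => by ext i; simp
      map_smul' := fun r x => by ext i; simp }
  have hπ : Function.Surjective (Res.lift π) := fun y => by
    choose x hx using fun i => toHypersurface_surjective f (Res.val f y i)
    exact ⟨x, funext hx⟩
  obtain ⟨B, hB⟩ := exists_lift_of_surjective g hg (Res.lift (β.comp π))
  obtain ⟨A, hA⟩ := exists_lift_of_surjective (Res.lift π) hπ
    (Res.lift (α.comp ((Res.val f).comp g)))
  have hker : ∀ x, g (c • x - B (A x)) = 0 := fun x => by
    have h1 : Res.val f (g (B (A x))) = β (α (Res.val f (g x))) := by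
      rw [hB]
      exact congrArg β (hA x)
    have h2 : β (α (Res.val f (g x))) = toHypersurface f c • Res.val f (g x) :=
      (LinearMap.congr_fun hαβ _).symm
    rw [map_sub, map_smul, sub_eq_zero]
    exact (h1.trans h2).symm
  let K := LinearMap.ker g
  let D : (Fin n → BranchedCover f) →ₗ[BranchedCover f] K :=
    (c • LinearMap.id - B ∘ₗ A).codRestrict K hker
  let Z := LinearMap.lsmul (BranchedCover f) (Fin m → BranchedCover f) (zVar f)
  have hZ : Function.Injective Z := by
    rw [← LinearMap.ker_eq_bot, LinearMap.ker_eq_bot']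
    exact fun x hx => funext fun i => zVar_mul_cancel f hf0 (congrFun hx i)
  -- On `K` the map `α ∘ g` vanishes, so the entries of `A x` reduce to zero in `R` and are
  -- multiples of `z`.
  obtain ⟨A', hA'⟩ := exists_lift_of_injective Z hZ (A ∘ₗ K.subtype) fun x => by
    have h : ∀ i, toHypersurface f (A x.1 i) = 0 := fun i => by
      have h := hA x.1
      have hx : g x.1 = 0 := x.2
      have h2 : π (A x.1) = α (Res.val f (g x.1)) := h
      rw [hx, map_zero, map_zero] at h2
      exact congrFun h2 i
    have : ∀ i, ∃ b, zVar f * b = A x.1 i := fun i => by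
      have h := h i ▸ fromHypersurface_toHypersurface f (A x.1 i)
      rw [map_zero, eq_comm, Ideal.Quotient.eq_zero_iff_mem,
        Ideal.mem_span_singleton] at h
      obtain ⟨b, hb⟩ := h
      exact ⟨b, hb.symm⟩
    choose b hb using this
    exact ⟨b, funext hb⟩
  let B' : (Fin m → BranchedCover f) →ₗ[BranchedCover f] K :=
    (B ∘ₗ Z).codRestrict K fun x => by
      change g (B (zVar f • x)) = 0
      rw [map_smul, map_smul, Res.zVar_smul]
  convert add_mem (comp_mem_projMaps K.subtype D) (comp_mem_projMaps A' B') using 1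
  ext1 x
  apply Subtype.ext
  change c • x.1 = (c • x.1 - B (A x.1)) + B (Z (A' x))
  rw [hA']
  simp

theorem stableAnn_ker_eq [IsDomain S] (hf0 : f ≠ 0) (hg : Function.Surjective g) :
    stableAnn (BranchedCover f) (LinearMap.ker g) =
      (stableAnn (Hypersurface f) N).comap (toHypersurface f) := by
  refine le_antisymm (stableAnn_le_comap_stableAnn_modZ.trans (Ideal.comap_mono ?_))
    (comap_stableAnn_le_stableAnn_ker hf0 hg)
  obtain ⟨s, hs⟩ := exists_section_syzygyRetraction hg
  exact stableAnn_le_of_leftInverse s _ hs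

end Syzygy

/-! ### Covers free over the base: `M` as a summand of `Ω(M/zM)`. -/

section Free

variable {M : Type u} [AddCommGroup M] [Module (BranchedCover f) M]

/-- The element `z ⊗ 1 + 1 ⊗ z` is central for the two actions of `R♯`, since `z² = -f` lies in `S`,
and multiplication sends it to `2z`. As `M` is free over `S`, the module `R♯ ⊗ M` in the middle is
projective over `R♯`. -/
theorem two_mul_zVar_mem_stableAnn [IsLocalRing S] [IsAdicComplete (maximalIdeal S) S]
    (hf : f ∈ maximalIdeal S) [Module S M] [IsScalarTower S (BranchedCover f) M]
    [Module.Free S M] [Module.Finite S M] : 2 * zVar f ∈ stableAnn (BranchedCover f) M := by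
  rw [mem_stableAnn_iff]
  let a : M →ₗ[BranchedCover f] BranchedCover f ⊗[S] M :=
    { toFun := fun m => zVar f ⊗ₜ m + 1 ⊗ₜ (zVar f • m)
      map_add' := fun x y => by
        rw [TensorProduct.tmul_add, smul_add, TensorProduct.tmul_add]
        abel
      map_smul' := fun b m => by
        obtain ⟨s, t, rfl⟩ := exists_eq_add_mul_zVar hf b
        have hz : ∀ y : M, zVar f • zVar f • y = -(f • y) := fun y => by
          rw [smul_smul, zVar_mul_self, neg_smul, algebraMap_smul]
        have hz' : zVar f • ((zVar f : BranchedCover f) ⊗ₜ[S] m + 1 ⊗ₜ (zVar f • m)) =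
            zVar f ⊗ₜ (zVar f • m) + 1 ⊗ₜ (zVar f • zVar f • m) := by
          rw [smul_add, TensorProduct.smul_tmul', TensorProduct.smul_tmul', smul_eq_mul,
            zVar_mul_self, smul_eq_mul, mul_one, hz, TensorProduct.tmul_neg,
            TensorProduct.neg_tmul, Algebra.algebraMap_eq_smul_one,
            TensorProduct.smul_tmul f (1 : BranchedCover f) m]
          abel
        rw [RingHom.id_apply, add_smul, add_smul, mul_smul, mul_smul, hz', algebraMap_smul,
          algebraMap_smul, algebraMap_smul, algebraMap_smul, smul_add (zVar f),
          smul_comm (zVar f) s, smul_comm (zVar f) t]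
        simp only [TensorProduct.tmul_add, TensorProduct.tmul_smul, smul_add]
        abel }
  refine ⟨BranchedCover f ⊗[S] M, inferInstance, inferInstance, inferInstance, inferInstance,
    a, (LinearMap.id : M →ₗ[S] M).liftBaseChange (BranchedCover f), ?_⟩
  ext m
  simp [a, two_mul, add_smul]

theorem zVar_smul_injective [IsDomain S] (hf0 : f ≠ 0) [Module S M]
    [IsScalarTower S (BranchedCover f) M] [Module.Free S M] {m : M} (h : zVar f • m = 0) :
    m = 0 := by
  have h2 : f • m = 0 := by
    have h3 : zVar f • zVar f • m = 0 := by rw [h, smul_zero]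
    rwa [smul_smul, zVar_mul_self, neg_smul, algebraMap_smul, neg_eq_zero] at h3
  exact (smul_eq_zero_iff_right hf0).1 h2

/-- For a free cover `q` of `M`, the syzygy of `M/zM` is `q⁻¹(zM)`. A lift through `q` of the
factorization of `z • id` maps `M` into it, and `q` followed by division by `z` is a retraction. -/
theorem comap_stableAnn_modZ_le [IsDomain S] (hf0 : f ≠ 0) [Module.Finite (BranchedCover f) M]
    (hz : ∀ m : M, zVar f • m = 0 → m = 0) (hzM : zVar f ∈ stableAnn (BranchedCover f) M) :
    (stableAnn (Hypersurface f) (ModZ f M)).comap (toHypersurface f) ≤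
      stableAnn (BranchedCover f) M := by
  obtain ⟨n, q, hq⟩ := Module.Finite.exists_fin' (BranchedCover f) M
  let g : (Fin n → BranchedCover f) →ₗ[BranchedCover f] Res f (ModZ f M) :=
    Res.lift ((ModZ.mk f M).comp q)
  have hg : Function.Surjective g := (ModZ.mk_surjective f).comp hq
  refine (comap_stableAnn_le_stableAnn_ker hf0 hg).trans ?_
  rw [mem_stableAnn_iff] at hzM
  obtain ⟨m, α, β, hαβ⟩ := exists_fin_of_mem_projMaps hzM
  obtain ⟨γ, hγ⟩ := exists_lift_of_surjective q hq β
  have hqs : ∀ x, q (γ (α x)) = zVar f • x := fun x => by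
    rw [hγ]
    exact (LinearMap.congr_fun hαβ x).symm
  let s : M →ₗ[BranchedCover f] LinearMap.ker g := (γ ∘ₗ α).codRestrict _ fun x => by
    change ModZ.mk f M (q (γ (α x))) = 0
    exact (ModZ.mk_eq_zero_iff f).2 ⟨x, (hqs x).symm⟩
  let Z := LinearMap.lsmul (BranchedCover f) M (zVar f)
  have hZ : Function.Injective Z := by
    rw [← LinearMap.ker_eq_bot, LinearMap.ker_eq_bot']
    exact hz
  obtain ⟨r, hr⟩ := exists_lift_of_injective Z hZ (q ∘ₗ (LinearMap.ker g).subtype)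
    fun x => (ModZ.mk_eq_zero_iff f).1 (show ModZ.mk f M (q x.1) = 0 from x.2)
  refine stableAnn_le_of_leftInverse s r fun x => hZ ?_
  rw [hr]
  exact hqs x

end Free

end Branched

/-! ### Maximal Cohen-Macaulayness of reductions and syzygies. -/

section Depth

theorem natCast_le_depth_of_flat {A : Type u} [CommRing A] [IsLocalRing A] {n : ℕ}
    (h : (n : ℕ∞) ≤ depth A A) (F : Type*) [AddCommGroup F] [Module A F] [Module.Flat A F]
    [Module.Finite A F] : (n : ℕ∞) ≤ depth A F := by
  rcases subsingleton_or_nontrivial F with hF | hF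
  · simp [depth, hF]
  obtain ⟨rs, hlen, hmem, hreg⟩ := exists_isRegular_of_natCast_le_depth h
  refine le_trans (by simpa using hlen) (natCast_le_depth_of_isRegular hmem
    (.of_isWeaklyRegular_of_mem_maximalIdeal _ hmem ?_))
  exact ((TensorProduct.rid A F).isWeaklyRegular_congr rs).1
    (IsWeaklyRegular.isWeaklyRegular_lTensor (M₂ := F) hreg.toIsWeaklyRegular)

theorem isMCM_iff_of_ringKrullDim_eq {A : Type*} [CommRing A] {n : ℕ} (hA : ringKrullDim A = n)
    (M : Type*) [AddCommGroup M] [Module A M] :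
    IsMCM A M ↔ Module.Finite A M ∧ (n : ℕ∞) ≤ depth A M := by
  rw [IsMCM, hA]
  norm_cast

end Depth

section Branched

variable {S : Type u} [CommRing S] {f : S}

theorem natCast_le_depth_modZ [IsLocalRing S] [IsNoetherianRing S] (hf : f ∈ maximalIdeal S) {M : Type u} [AddCommGroup M]
    [Module (BranchedCover f) M] [Module.Finite (BranchedCover f) M]
    (hz : ∀ m : M, zVar f • m = 0 → m = 0) {n : ℕ}
    (h : ((n + 1 : ℕ) : ℕ∞) ≤ depth (BranchedCover f) M) :
    (n : ℕ∞) ≤ depth (Hypersurface f) (ModZ f M) := by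
  have := isLocalRing_branchedCover hf
  have := nontrivial_hypersurface hf
  have hreg : IsSMulRegular M (zVar f) := fun x y hxy =>
    sub_eq_zero.1 (hz _ (by rw [smul_sub, sub_eq_zero]; exact hxy))
  let e : QuotSMulTop (zVar f) M ≃+ ModZ f M :=
    (Submodule.quotEquivOfEq _ _ (Submodule.ideal_span_singleton_smul (zVar f) ⊤).symm).toAddEquiv
  refine le_of_le_of_eq (natCast_le_depth_quotSMulTop hreg h)
    (depth_eq_of_surjective (toHypersurface_surjective f) e fun a m => ?_)
  obtain ⟨m, rfl⟩ := Submodule.Quotient.mk_surjective _ m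
  exact map_smulₛₗ (ModZ.mk f M) a m

theorem depth_res [IsLocalRing S] (hf : f ∈ maximalIdeal S) (N : Type u) [AddCommGroup N]
    [Module (Hypersurface f) N] : depth (BranchedCover f) (Res f N) = depth (Hypersurface f) N :=
  have := isLocalRing_branchedCover hf
  have := nontrivial_hypersurface hf
  depth_eq_of_surjective (toHypersurface_surjective f) (AddEquiv.refl N) fun _ _ => rfl

theorem finite_modZ (M : Type u) [AddCommGroup M] [Module (BranchedCover f) M]
    [Module.Finite (BranchedCover f) M] : Module.Finite (Hypersurface f) (ModZ f M) :=
  Module.Finite.of_surjective (ModZ.mk f M) (ModZ.mk_surjective f)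

theorem exists_surjective_res (N : Type u) [AddCommGroup N] [Module (Hypersurface f) N]
    [Module.Finite (Hypersurface f) N] :
    ∃ (n : ℕ) (g : (Fin n → BranchedCover f) →ₗ[BranchedCover f] Res f N),
      Function.Surjective g := by
  obtain ⟨n, q, hq⟩ := Module.Finite.exists_fin' (Hypersurface f) N
  let π : (Fin n → BranchedCover f) →ₛₗ[toHypersurface f] (Fin n → Hypersurface f) :=
    { toFun := fun x i => toHypersurface f (x i)
      map_add' := fun x y => by ext i; simp
      map_smul' := fun r x => by ext i; simp }
  refine ⟨n, Res.lift (q.comp π), fun y => ?_⟩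
  obtain ⟨v, hv⟩ := hq y
  choose x hx using fun i => toHypersurface_surjective f (v i)
  exact ⟨x, (congrArg q (funext hx)).trans hv⟩

end Branched

section MvPowerSeries

instance isDomain_mvPowerSeries (σ : Type*) (k : Type*) [Field k] : IsDomain (MvPowerSeries σ k) :=
  NoZeroDivisors.to_isDomain _

variable {k : Type u} [Field k] {d : ℕ} {f : MvPowerSeries (Fin (d + 1)) k}

theorem ringKrullDim_hypersurface (hf : f ∈ maximalIdeal (MvPowerSeries (Fin (d + 1)) k))
    (hf0 : f ≠ 0) : ringKrullDim (Hypersurface f) = d := by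
  have h := ringKrullDim_hypersurface_add_one hf hf0
  rw [ringKrullDim_mvPowerSeries] at h
  exact ENat.WithBot.add_one_cancel.1 (by simpa using h)

theorem ringKrullDim_branchedCover (hf : f ∈ maximalIdeal (MvPowerSeries (Fin (d + 1)) k)) :
    ringKrullDim (BranchedCover f) = (d + 1 : ℕ) := by
  have h := ringKrullDim_branchedCover_add_one hf
  rw [ringKrullDim_mvPowerSeries] at h
  exact ENat.WithBot.add_one_cancel.1 h

theorem isMCM_ker (hf : f ∈ maximalIdeal (MvPowerSeries (Fin (d + 1)) k)) (hf0 : f ≠ 0)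
    {N : Type u} [AddCommGroup N] [Module (Hypersurface f) N] (hN : IsMCM (Hypersurface f) N)
    {n : ℕ} (g : (Fin n → BranchedCover f) →ₗ[BranchedCover f] Res f N)
    (hg : Function.Surjective g) : IsMCM (BranchedCover f) (LinearMap.ker g) := by
  have := isLocalRing_branchedCover hf
  rw [isMCM_iff_of_ringKrullDim_eq (ringKrullDim_hypersurface hf hf0)] at hN
  rw [isMCM_iff_of_ringKrullDim_eq (ringKrullDim_branchedCover hf)]
  -- The free module has depth at least `d + 1` and `N` at least `d`, which is what the depth lemma
  -- needs.
  refine ⟨inferInstance, natCast_add_one_le_depth_ker g hg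
    (natCast_le_depth_of_flat (natCast_le_depth_branchedCover hf
      (natCast_le_depth_mvPowerSeries k (d + 1))) _) ?_⟩
  rw [depth_res hf]
  exact hN.2

/-- Depth at least `d + 1` over `R♯` descends to `S`, which has `d + 1` variables, so `M` is free
over `S`. -/
theorem zVar_mem_stableAnn_and_injective [CharZero k]
    (hf : f ∈ maximalIdeal (MvPowerSeries (Fin (d + 1)) k))
    (hf0 : f ≠ 0) {M : Type u} [AddCommGroup M] [Module (BranchedCover f) M]
    (hM : IsMCM (BranchedCover f) M) :
    zVar f ∈ stableAnn (BranchedCover f) M ∧ ∀ m : M, zVar f • m = 0 → m = 0 := by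
  have := isLocalRing_branchedCover hf
  have := finite_branchedCover hf
  have := isLocalHom_algebraMap_branchedCover hf
  rw [isMCM_iff_of_ringKrullDim_eq (ringKrullDim_branchedCover hf)] at hM
  obtain ⟨hfin, hdepth⟩ := hM
  let : Module (MvPowerSeries (Fin (d + 1)) k) M :=
    Module.compHom M (algebraMap (MvPowerSeries (Fin (d + 1)) k) (BranchedCover f))
  have : IsScalarTower (MvPowerSeries (Fin (d + 1)) k) (BranchedCover f) M :=
    ⟨fun s b m =>
      (congrArg (· • m) (Algebra.smul_def s b)).trans (mul_smul _ b m)⟩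
  have : Module.Finite (MvPowerSeries (Fin (d + 1)) k) M := Module.Finite.trans (BranchedCover f) M
  have : Module.Free (MvPowerSeries (Fin (d + 1)) k) M :=
    free_mvPowerSeries_of_natCast_le_depth k (d + 1) M
      (natCast_le_depth_of_finite_extension (B := BranchedCover f) M hdepth)
  refine ⟨?_, fun m hm => zVar_smul_injective (S := MvPowerSeries (Fin (d + 1)) k) hf0 hm⟩
  have htwo : IsUnit (2 : BranchedCover f) := by
    have h2 : IsUnit (2 : k) := isUnit_iff_ne_zero.2 two_ne_zero
    have := h2.map ((algebraMap (MvPowerSeries (Fin (d + 1)) k) (BranchedCover f)).comp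
      (algebraMap k (MvPowerSeries (Fin (d + 1)) k)))
    rwa [map_ofNat] at this
  exact (Ideal.unit_mul_mem_iff_mem _ htwo).1 (two_mul_zVar_mem_stableAnn hf)

theorem isMCM_modZ [CharZero k] (hf : f ∈ maximalIdeal (MvPowerSeries (Fin (d + 1)) k))
    (hf0 : f ≠ 0) {M : Type u} [AddCommGroup M] [Module (BranchedCover f) M]
    (hM : IsMCM (BranchedCover f) M) : IsMCM (Hypersurface f) (ModZ f M) := by
  have hz := (zVar_mem_stableAnn_and_injective hf hf0 hM).2
  rw [isMCM_iff_of_ringKrullDim_eq (ringKrullDim_branchedCover hf)] at hM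
  rw [isMCM_iff_of_ringKrullDim_eq (ringKrullDim_hypersurface hf hf0)]
  have := hM.1
  exact ⟨finite_modZ M, natCast_le_depth_modZ hf hz hM.2⟩

theorem stableAnn_eq_comap_stableAnn_modZ [CharZero k]
    (hf : f ∈ maximalIdeal (MvPowerSeries (Fin (d + 1)) k))
    (hf0 : f ≠ 0) {M : Type u} [AddCommGroup M] [Module (BranchedCover f) M]
    (hM : IsMCM (BranchedCover f) M) : stableAnn (BranchedCover f) M =
      (stableAnn (Hypersurface f) (ModZ f M)).comap (toHypersurface f) := by
  obtain ⟨hzM, hz⟩ := zVar_mem_stableAnn_and_injective hf hf0 hM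
  have := hM.1
  exact le_antisymm stableAnn_le_comap_stableAnn_modZ (comap_stableAnn_modZ_le hf0 hz hzM)

end MvPowerSeries

/-! ### Kolmogorov quotients in terms of stable annihilators. -/

section Space

instance isUpperSet_CM (R : Type u) [CommRing R] : Topology.IsUpperSet (CM R) := ⟨rfl⟩

theorem CM.inseparable_iff {R : Type u} [CommRing R] {x y : CM R} :
    Inseparable x y ↔ CM.ann x = CM.ann y := by
  rw [inseparable_iff_specializes_and, Topology.IsUpperSet.specializes_iff_le,
    Topology.IsUpperSet.specializes_iff_le, and_comm]
  exact (le_antisymm_iff (a := CM.ann x)).symm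

theorem CM.ann_of {R : Type u} [CommRing R] (M : Type u) [AddCommGroup M] [Module R M]
    (hM : IsMCM R M) : CM.ann (CM.of M hM) = stableAnn R M := rfl

/-- Two maps that match stable annihilators along an order embedding of ideals induce inverse
homeomorphisms of the Kolmogorov quotients. -/
noncomputable def separationQuotientHomeomorph {A B : Type u} [CommRing A] [CommRing B]
    {c : Ideal B → Ideal A} (hc : ∀ I J, c I ≤ c J ↔ I ≤ J) (F : CM A → CM B) (G : CM B → CM A)
    (hF : ∀ x, CM.ann x = c (CM.ann (F x))) (hG : ∀ y, CM.ann (G y) = c (CM.ann y)) :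
    SeparationQuotient (CM A) ≃ₜ SeparationQuotient (CM B) :=
  have hcF : Continuous F := Topology.IsUpperSet.monotone_iff_continuous.1 fun x y h => by
    change CM.ann x ≤ CM.ann y at h
    rwa [hF x, hF y, hc] at h
  have hcG : Continuous G := Topology.IsUpperSet.monotone_iff_continuous.1 fun x y h => by
    change CM.ann (G x) ≤ CM.ann (G y)
    rw [hG x, hG y, hc]
    exact h
  { toFun := SeparationQuotient.lift (SeparationQuotient.mk ∘ F) fun _ _ h =>
      SeparationQuotient.mk_eq_mk.2 (h.map hcF)
    invFun := SeparationQuotient.lift (SeparationQuotient.mk ∘ G) fun _ _ h =>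
      SeparationQuotient.mk_eq_mk.2 (h.map hcG)
    left_inv := by
      intro x
      obtain ⟨x, rfl⟩ := SeparationQuotient.surjective_mk x
      refine SeparationQuotient.mk_eq_mk.2 (CM.inseparable_iff.2 ?_)
      rw [hG, ← hF]
    right_inv := by
      intro y
      obtain ⟨y, rfl⟩ := SeparationQuotient.surjective_mk y
      refine SeparationQuotient.mk_eq_mk.2 (CM.inseparable_iff.2 ?_)
      have h := (hF (G y)).symm.trans (hG y)
      exact le_antisymm ((hc _ _).1 h.le) ((hc _ _).1 h.ge)
    continuous_toFun := SeparationQuotient.continuous_lift_iff.2 (SeparationQuotient.continuous_mk.comp hcF)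
    continuous_invFun := SeparationQuotient.continuous_lift_iff.2 (SeparationQuotient.continuous_mk.comp hcG)}

end Space

end AlexandrovMCM

open AlexandrovMCM in
/-- The homeomorphism between the Kolmogorov quotients is induced by `M ↦ M/zM`, and its inverse
by `N ↦ Ω N`, where the syzygy `Ω N` is the kernel of any surjection from a free `R^♯`-module of
finite rank onto `N`. -/
theorem proposition5p3 {k : Type u} [Field k] [IsAlgClosed k] [CharZero k] (d : ℕ)
    (f : MvPowerSeries (Fin (d + 1)) k)
    (hf : f ∈ IsLocalRing.maximalIdeal (MvPowerSeries (Fin (d + 1)) k)) (hf0 : f ≠ 0) :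
    ∃ e : SeparationQuotient (CM (BranchedCover f)) ≃ₜ SeparationQuotient (CM (Hypersurface f)),
      (∀ (M : Type u) [AddCommGroup M] [Module (BranchedCover f) M]
        (hM : IsMCM (BranchedCover f) M),
        ∃ h : IsMCM (Hypersurface f) (ModZ f M),
          e (SeparationQuotient.mk (CM.of M hM)) =
            SeparationQuotient.mk (CM.of (ModZ f M) h)) ∧
      (∀ (N : Type u) [AddCommGroup N] [Module (Hypersurface f) N]
        (hN : IsMCM (Hypersurface f) N)
        (n : ℕ) (g : (Fin n → BranchedCover f) →ₗ[BranchedCover f] Res f N),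
        Function.Surjective g →
        ∃ h : IsMCM (BranchedCover f) (LinearMap.ker g),
          e.symm (SeparationQuotient.mk (CM.of N hN)) =
            SeparationQuotient.mk (CM.of (LinearMap.ker g) h)) := by
  have hc : ∀ I J : Ideal (Hypersurface f),
      I.comap (toHypersurface f) ≤ J.comap (toHypersurface f) ↔ I ≤ J := fun I J =>
    Ideal.comap_le_comap_iff_of_surjective _ (toHypersurface_surjective f) I J
  have hexF : ∀ x : CM (BranchedCover f), ∃ y : CM (Hypersurface f),
      CM.ann x = (CM.ann y).comap (toHypersurface f) := fun x => by
    obtain ⟨M, rfl⟩ := Quotient.exists_rep x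
    exact ⟨CM.of (ModZ f M.carrier) (isMCM_modZ hf hf0 M.isMCM),
      stableAnn_eq_comap_stableAnn_modZ hf hf0 M.isMCM⟩
  have hexG : ∀ y : CM (Hypersurface f), ∃ x : CM (BranchedCover f),
      CM.ann x = (CM.ann y).comap (toHypersurface f) := fun y => by
    obtain ⟨N, rfl⟩ := Quotient.exists_rep y
    have := N.isMCM.1
    obtain ⟨n, g, hg⟩ := exists_surjective_res (f := f) N.carrier
    exact ⟨CM.of (LinearMap.ker g) (isMCM_ker hf hf0 N.isMCM g hg), stableAnn_ker_eq hf0 hg⟩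
  -- Arbitrary choices suffice: a class in the Kolmogorov quotient is determined by its annihilator,
  -- so neither functoriality of `M/zM` nor independence of `ΩN` from the cover has to be checked on
  -- stable isomorphism classes.
  choose F hF using hexF
  choose G hG using hexG
  refine ⟨separationQuotientHomeomorph (c := Ideal.comap (toHypersurface f)) hc F G hF hG,
    fun M _ _ hM => ⟨isMCM_modZ hf hf0 hM, ?_⟩,
    fun N _ _ hN n g hg => ⟨isMCM_ker hf hf0 hN g hg, ?_⟩⟩
  · refine SeparationQuotient.mk_eq_mk.2 (CM.inseparable_iff.2 ?_)
    have h := (hF (CM.of M hM)).symm.trans (stableAnn_eq_comap_stableAnn_modZ hf hf0 hM)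
    exact le_antisymm ((hc _ _).1 h.le) ((hc _ _).1 h.ge)
  · refine SeparationQuotient.mk_eq_mk.2 (CM.inseparable_iff.2 ?_)
    rw [hG, CM.ann_of, CM.ann_of, stableAnn_ker_eq hf0 hg]
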